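/- Let $\lambda>0$, $p\in[0,1]$ and $D>0$. For $T>0$ let $\mathbf X$ be a homogeneous Poisson process of intensity $\lambda$ on $[0,T]$, and let each of its points be known to the reconstructor independently with probability $p$; let $\mathbf S\subseteq\mathbf X$ be the pattern of known points. In the Wyner–Ziv setting, a code of rate $R$ (bits per second) on $[0,T]$ consists of an encoder $f_T$ that maps $\mathbf X$ (without knowledge of $\mathbf S$) to a message in $\{1,\dots,\lfloor 2^{TR}\rfloor\}$, and a reconstructor $\phi_T$ that maps the message and $\mathbf S$ to a Lebesgue-measurable signal $\hat x\colon[0,T]\to\{0,1\}$. The distortion between a pattern $\mathbf x$ and a signal $\hat{\mathbf x}$ is the Lebesgue measure of $\hat x^{-1}(1)$ divided by $T$ if all points of $\mathbf x$ lie in $\hat x^{-1}(1)$, and $\infty$ otherwise. The pair $(R,D)$ is achievable if for every $\epsilon>0$ there is $T_0>0$ such that for every $T>T_0$ there is a code of rate $R+\epsilon$ on $[0,T]$ whose expected distortion is at most $D+\epsilon$. Let $$R_{\mathrm{Pois}}(D,\nu)=\begin{cases}-\nu\log_2 D,& 0<D<1,\\ 0,& D\ge 1.\end{cases}$$ Then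 the minimum $R_{\mathrm{WZ}}(D,\lambda,p)$ of all rates $R$ for which $(R,D)$ is achievable in the Wyner–Ziv setting exists, and $$R_{\mathrm{WZ}}(D,\lambda,p)=R_{\mathrm{Pois}}(D,(1-p)\lambda).$$ This is also the minimum achievable rate in the setting in which the encoder is allowed to depend on both $\mathbf X$ and $\mathbf S$, all else being the same: knowing the points at the reconstructor only is as good as knowing them also at the encoder. -/

import Mathlib

open MeasureTheory ProbabilityTheory Set
open scoped ENNReal NNReal

noncomputable section

namespace PoissonCover

/-! ### The source: a Poisson process whose points are independently revealed -/

/-- Elementary outcomes `(n, v, b)`: the number `n` of points on `[0, T]`, positions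
`v 0, v 1, …` in `[0, 1]` (to be rescaled by `T`), and marks `b 0, b 1, …`; the `i`-th point is
known to the reconstructor iff `b i = true`. -/
abbrev Sample : Type := ℕ × (ℕ → unitInterval) × (ℕ → Bool)

/-- The law of an independently marked homogeneous Poisson process of intensity `lam` on `[0, T]`:
the number of points is Poisson with mean `lam * T`, the points are i.i.d. uniform, the marks are
i.i.d. Bernoulli with parameter `p`, and number, positions and marks are independent. -/
def sampleLaw (lam T : ℝ) (p : unitInterval) : Measure Sample :=
  (poissonMeasure (lam * T).toNNReal).prod
    ((Measure.infinitePi fun _ : ℕ => (volume : Measure unitInterval)).prod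
      (Measure.infinitePi fun _ : ℕ => bernoulliMeasure true false p))

open Classical in
/-- The point pattern `X` of the Poisson process on `[0, T]`. -/
def points (T : ℝ) (ω : Sample) : Finset ℝ :=
  (Finset.range ω.1).image fun i => T * (ω.2.1 i : ℝ)

open Classical in
/-- The pattern of those points of the Poisson process that are known to the reconstructor. -/
def knownPoints (T : ℝ) (ω : Sample) : Finset ℝ :=
  ((Finset.range ω.1).filter fun i => ω.2.2 i = true).image fun i => T * (ω.2.1 i : ℝ)

/-! ### Codes and distortion -/

/-- The usual σ-algebra on point patterns (finite subsets of the line): the one generated by the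
numbers of points in Borel sets. -/
abbrev patternSigma : MeasurableSpace (Finset ℝ) :=
  ⨆ (B : Set ℝ) (_ : MeasurableSet B),
    MeasurableSpace.comap (fun x : Finset ℝ => ((x : Set ℝ) ∩ B).ncard) ⊤

/-- The messages `1, …, 2 ^ (T R)` of a code of rate `R` (bits per second) on `[0, T]`. -/
abbrev Message (T R : ℝ) : Type := Fin ⌊(2 : ℝ) ^ (T * R)⌋₊

open Classical in
/-- The distortion between a pattern `x` and the `{0, 1}`-valued signal on `[0, T]` that takes the
value `1` exactly on `A`. -/
def distortion (T : ℝ) (x : Finset ℝ) (A : Set ℝ) : ℝ≥0∞ :=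
  if (x : Set ℝ) ⊆ A then volume A / ENNReal.ofReal T else ⊤

/-- A reconstructor: from the message and the pattern of known points it produces a
Lebesgue measurable `{0, 1}`-valued signal on `[0, T]`, given by the set where it equals `1`. -/
structure Reconstructor (T R : ℝ) where
  toFun : Message T R → Finset ℝ → Set ℝ
  subset_Icc : ∀ m s, toFun m s ⊆ Icc 0 T
  lebesgueMeasurable : ∀ m s, NullMeasurableSet (toFun m s) volume

/-- The expectation of the `[0, ∞]`-valued random variable `d` exists and is at most `c`. -/
def ExpectationLE (P : Measure Sample) (d : Sample → ℝ≥0∞) (c : ℝ) : Prop :=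
  AEMeasurable d P ∧ ∫⁻ ω, d ω ∂P ≤ ENNReal.ofReal c

/-- `(R, D)` is achievable in the Wyner–Ziv setting: the encoder sees the pattern `X` only, the
reconstructor sees the message and the pattern of known points. -/
def WZAchievable (lam : ℝ) (p : unitInterval) (R D : ℝ) : Prop :=
  ∀ ε > 0, ∃ T₀ > 0, ∀ T > T₀,
    ∃ (f : Finset ℝ → Message T (R + ε)) (φ : Reconstructor T (R + ε)),
      Measurable[patternSigma, ⊤] f ∧
      ExpectationLE (sampleLaw lam T p)
        (fun ω => distortion T (points T ω)
          (φ.toFun (f (points T ω)) (knownPoints T ω)))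
        (D + ε)

/-- `(R, D)` is achievable when the encoder, too, knows which points are known to the
reconstructor. -/
def InformedAchievable (lam : ℝ) (p : unitInterval) (R D : ℝ) : Prop :=
  ∀ ε > 0, ∃ T₀ > 0, ∀ T > T₀,
    ∃ (f : Finset ℝ × Finset ℝ → Message T (R + ε)) (φ : Reconstructor T (R + ε)),
      Measurable[patternSigma.prod patternSigma, ⊤] f ∧
      ExpectationLE (sampleLaw lam T p)
        (fun ω => distortion T (points T ω)
          (φ.toFun (f (points T ω, knownPoints T ω)) (knownPoints T ω)))
        (D + ε)

/-- `R_Pois(D, lam)` in bits per second, for `D > 0`: `-lam log₂ D` if `D < 1`, and `0` if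
`D ≥ 1`. -/
def ratePois (D lam : ℝ) : ℝ :=
  if D < 1 then -lam * Real.logb 2 D else 0

end PoissonCover

end

noncomputable section

open MeasureTheory ProbabilityTheory Set
open scoped ENNReal NNReal

namespace PoissonCover

/-! Converse (already for informed encoders). Condition on the number of points, the marks and the
known points. The `k` unknown points remain i.i.d. uniform, and each of the `W` messages now stands
for a fixed set. A set of relative measure `x` contains all unknown points with probability at most
`x ^ k`, so summing over messages gives `E[d⁻¹ ^ k] ≤ W` for the distortion `d`
(`lintegral_informedDistortion_inv_pow_le`). Convexity of `x ↦ x⁻¹ ^ k`, used through a tangent line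
at some `c` slightly above `D`, and concentration of `k` near `(1 - p) * lam * T` turn this into `W
≥ const * c⁻¹ ^ k₀` (`card_message_ge`). Letting `c` and the concentration threshold tend to their
limits gives the rate.

Achievability: random covering with Wyner–Ziv binning. Cut `[0, T]` into `N` large cells of `q`
small ones; a random codeword takes a cyclic run of `a` small cells in each large cell. With `d = a
/ q`, it has relative measure at most `d` and covers `n` points in distinct large cells with
probability exactly `d ^ n` (`card_covers`). About `d ^ (-lam * T)` codewords suffice for one to
cover all points, and a wrong codeword covers the known points with probability about `d ^ (p * lam
* T)`. Hashing the codeword index to about `d ^ (-(1 - p) * lam * T)` values therefore leaves,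
typically, one candidate (`card_codingFailure_le`). The decoder outputs the union of all candidates,
so no point is ever missed and a failure costs distortion at most `1`; averaging then yields a
deterministic code (`exists_code`). -/

/-! ### Tail bounds for the numbers of marked points -/

/-- The number of points whose mark satisfies `c`. -/
def markCount (c : Bool → Bool) (ω : Sample) : ℕ :=
  ((Finset.range ω.1).filter fun i => c (ω.2.2 i) = true).card

instance (lam T : ℝ) (p : unitInterval) : IsProbabilityMeasure (sampleLaw lam T p) := by
  unfold sampleLaw; infer_instance

lemma lintegral_poissonMeasure (r : ℝ≥0) (f : ℕ → ℝ≥0∞) :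
    ∫⁻ n, f n ∂poissonMeasure r =
      ∑' n, ENNReal.ofReal (Real.exp (-r) * r ^ n / n.factorial) * f n := by
  rw [poissonMeasure, lintegral_sum_measure]
  simp [lintegral_smul_measure]

lemma lintegral_pow_poissonMeasure (r : ℝ≥0) {y : ℝ} (hy : 0 ≤ y) :
    ∫⁻ n, ENNReal.ofReal y ^ n ∂poissonMeasure r = ENNReal.ofReal (Real.exp (r * (y - 1))) := by
  rw [lintegral_poissonMeasure]
  have h := ((NormedSpace.expSeries_div_hasSum_exp ((r : ℝ) * y)).mul_left (Real.exp (-r)))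
  rw [← Real.exp_eq_exp_ℝ, ← Real.exp_add] at h
  rw [show (r : ℝ) * (y - 1) = -r + r * y by ring, ← h.tsum_eq,
    ENNReal.ofReal_tsum_of_nonneg (fun n => by positivity) h.summable]
  congr 1 with n
  rw [← ENNReal.ofReal_pow hy, ← ENNReal.ofReal_mul (by positivity)]
  congr 1
  rw [mul_pow]
  ring

lemma lintegral_infinitePi_prod_range {X : Type*} [MeasurableSpace X] (μ : Measure X)
    [IsProbabilityMeasure μ] (g : X → ℝ≥0∞) (hg : Measurable g) (n : ℕ) :
    ∫⁻ b, ∏ i ∈ Finset.range n, g (b i) ∂(Measure.infinitePi fun _ : ℕ => μ) =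
      (∫⁻ x, g x ∂μ) ^ n := by
  have hind := iIndepFun_infinitePi (P := fun _ : ℕ => μ) (X := fun _ => g) (fun _ => hg)
  rw [lintegral_prod_eq_prod_lintegral_of_indepFun (Finset.range n) _ hind
    (fun i => hg.comp (measurable_pi_apply i))]
  have h (i : ℕ) : ∫⁻ b, g (b i) ∂(Measure.infinitePi fun _ : ℕ => μ) = ∫⁻ x, g x ∂μ :=
    (measurePreserving_eval_infinitePi (fun _ : ℕ => μ) i).lintegral_comp hg
  simp [h]

/-- The probability that a mark satisfies `c`. -/
def markProb (p : unitInterval) (c : Bool → Bool) : ℝ :=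
  (if c true then (p : ℝ) else 0) + if c false then 1 - (p : ℝ) else 0

lemma markProb_nonneg (p : unitInterval) (c : Bool → Bool) : 0 ≤ markProb p c := by
  have := p.2.1; have := p.2.2
  unfold markProb; split_ifs <;> linarith

lemma measurable_markCount (c : Bool → Bool) : Measurable (markCount c) := by
  have : Measurable fun x : ℕ × Sample =>
      ((Finset.range x.1).filter fun i => c (x.2.2.2 i) = true).card := by
    refine measurable_from_prod_countable_right fun n => ?_
    simp only [Finset.card_filter]
    refine Finset.measurable_sum _ fun i _ => ?_
    exact (measurable_of_countable (fun b : Bool => if c b = true then 1 else 0)).comp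
      ((measurable_pi_apply i).comp measurable_snd.snd)
  exact this.comp (measurable_fst.prodMk measurable_id)

/-- Poisson thinning in generating-function form: given `n` points the marks contribute the `n`-th
power of a Bernoulli generating function, and averaging over `n` gives that of a Poisson variable of
mean `lam * T * markProb p c`. -/
lemma lintegral_pow_markCount {lam T : ℝ} (h : 0 ≤ lam * T) (p : unitInterval) (c : Bool → Bool)
    {x : ℝ} (hx : 0 ≤ x) :
    ∫⁻ ω, ENNReal.ofReal x ^ markCount c ω ∂sampleLaw lam T p =
      ENNReal.ofReal (Real.exp (lam * T * markProb p c * (x - 1))) := by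
  have hp0 := p.2.1
  have hp1 := p.2.2
  let g : Bool → ℝ≥0∞ := fun b => if c b = true then ENNReal.ofReal x else 1
  have hg : ∫⁻ b, g b ∂bernoulliMeasure true false p =
      ENNReal.ofReal (1 + markProb p c * (x - 1)) := by
    rw [bernoulliMeasure_def, lintegral_add_measure]
    have h1 : ((unitInterval.toNNReal p : ℝ≥0) : ℝ≥0∞) = ENNReal.ofReal p :=
      (ENNReal.ofReal_eq_coe_nnreal hp0).symm
    have h2 : ((unitInterval.toNNReal (unitInterval.symm p) : ℝ≥0) : ℝ≥0∞) =
        ENNReal.ofReal (1 - p) :=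
      (ENNReal.ofReal_eq_coe_nnreal (sub_nonneg.2 hp1)).symm
    change ∫⁻ b, g b ∂((unitInterval.toNNReal p : ℝ≥0∞) • Measure.dirac true) +
      ∫⁻ b, g b ∂((unitInterval.toNNReal (unitInterval.symm p) : ℝ≥0∞) • Measure.dirac false) = _
    rw [h1, h2, lintegral_smul_measure, lintegral_smul_measure, lintegral_dirac, lintegral_dirac]
    have key {y z : ℝ} (hy : 0 ≤ y) (hz : 0 ≤ z) : ENNReal.ofReal p * ENNReal.ofReal y +
        ENNReal.ofReal (1 - p) * ENNReal.ofReal z = ENNReal.ofReal (p * y + (1 - p) * z) := by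
      have : 0 ≤ 1 - (p : ℝ) := by linarith
      rw [← ENNReal.ofReal_mul hp0, ← ENNReal.ofReal_mul this, ← ENNReal.ofReal_add] <;> positivity
    have hg' (b : Bool) : g b = ENNReal.ofReal (if c b = true then x else 1) := by
      simp only [g]; split_ifs <;> simp
    rw [hg', hg', smul_eq_mul, smul_eq_mul, key (by split_ifs <;> linarith)
      (by split_ifs <;> linarith)]
    congr 1
    unfold markProb
    split_ifs <;> ring
  unfold sampleLaw
  have hmeas : Measurable fun ω : Sample => ENNReal.ofReal x ^ markCount c ω :=
    (measurable_of_countable fun k : ℕ => ENNReal.ofReal x ^ k).comp (measurable_markCount c)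
  rw [lintegral_prod _ hmeas.aemeasurable]
  have (n : ℕ) : ∫⁻ y, ENNReal.ofReal x ^ markCount c (n, y)
      ∂((Measure.infinitePi fun _ : ℕ => (volume : Measure unitInterval)).prod
      (Measure.infinitePi fun _ : ℕ => bernoulliMeasure true false p)) =
      ENNReal.ofReal (1 + markProb p c * (x - 1)) ^ n := by
    rw [lintegral_prod _ (show Measurable fun y : (ℕ → unitInterval) × (ℕ → Bool) =>
      ENNReal.ofReal x ^ markCount c (n, y) from hmeas.comp measurable_prodMk_left).aemeasurable]
    rw [← hg, ← lintegral_infinitePi_prod_range _ g (measurable_of_countable _)]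
    simp [markCount, g, Finset.prod_ite]
  simp only [this]
  rw [lintegral_pow_poissonMeasure _ ?_, Real.coe_toNNReal _ h]
  · congr 2; ring
  · have := markProb_nonneg p c
    have : markProb p c ≤ 1 := by unfold markProb; split_ifs <;> linarith
    nlinarith

lemma rate_neg {θ κ : ℝ} (hθ : 0 < θ) (hκ : 0 < κ) (hne : κ ≠ θ) :
    κ - θ - κ * Real.log (κ / θ) < 0 := by
  have h := Real.log_lt_sub_one_of_pos (x := θ / κ) (by positivity)
    (fun h => hne ((div_eq_one_iff_eq hκ.ne').1 h).symm)
  rw [← inv_div, Real.log_inv]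
  have : κ * Real.log (θ / κ) < κ * (θ / κ - 1) := by gcongr
  have h2 : κ * (θ / κ - 1) = θ - κ := by field_simp
  linarith

/-- Markov's inequality for `x ^ markCount` at the optimal tilt `x = κ / θ`. The hypothesis on `S`
serves both tails: it describes counts below `κ * T` when `x < 1` and above when `x > 1`. -/
lemma chernoff_markCount {lam T κ : ℝ} (hlam : 0 < lam) (hT : 0 < T) (p : unitInterval)
    (c : Bool → Bool) (hθ : 0 < markProb p c) (hκ : 0 < κ) (S : Set Sample)
    (hS : ∀ ω ∈ S, (κ / (lam * markProb p c)) ^ (κ * T) ≤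
      (κ / (lam * markProb p c)) ^ (markCount c ω : ℝ)) :
    sampleLaw lam T p S ≤ ENNReal.ofReal (Real.exp (T * (κ - lam * markProb p c -
      κ * Real.log (κ / (lam * markProb p c))))) := by
  set θ := lam * markProb p c with hθd
  have hθ' : 0 < θ := by positivity
  set x := κ / θ
  have hx : 0 < x := by positivity
  have hxp : 0 < x ^ (κ * T) := by positivity
  calc sampleLaw lam T p S
      ≤ sampleLaw lam T p {ω | ENNReal.ofReal (x ^ (κ * T)) ≤ ENNReal.ofReal x ^ markCount c ω} := by
        refine measure_mono fun ω hω => ?_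
        have := hS ω hω
        rw [Real.rpow_natCast] at this
        simp only [mem_ofPred_eq]
        rw [← ENNReal.ofReal_pow hx.le]
        exact ENNReal.ofReal_le_ofReal this
    _ ≤ (∫⁻ ω, ENNReal.ofReal x ^ markCount c ω ∂sampleLaw lam T p) / ENNReal.ofReal (x ^ (κ * T)) := by
        refine meas_ge_le_lintegral_div ?_ ?_ ?_
        · exact ((measurable_of_countable fun k : ℕ => ENNReal.ofReal x ^ k).comp
            (measurable_markCount c)).aemeasurable
        · simpa using hxp
        · simp
    _ = _ := by
        rw [lintegral_pow_markCount (by positivity) p c hx.le, ← ENNReal.ofReal_div_of_pos hxp,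
          Real.rpow_def_of_pos hx, ← Real.exp_sub]
        congr 2
        have : θ * x = κ := by simp only [x]; field_simp
        rw [← this, hθd]
        ring_nf

lemma tendsto_exp_mul_neg {I : ℝ} (hI : I < 0) :
    Filter.Tendsto (fun T : ℝ => ENNReal.ofReal (Real.exp (T * I))) Filter.atTop (nhds 0) := by
  rw [← ENNReal.ofReal_zero]
  exact ENNReal.tendsto_ofReal (Real.tendsto_exp_atBot.comp
    (Filter.tendsto_id.atTop_mul_const_of_neg hI))

lemma tendsto_markCount_lt {lam κ : ℝ} (hlam : 0 < lam) (p : unitInterval) (c : Bool → Bool)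
    (hκ : κ < lam * markProb p c) :
    Filter.Tendsto (fun T : ℝ => sampleLaw lam T p {ω | (markCount c ω : ℝ) < κ * T})
      Filter.atTop (nhds 0) := by
  rcases le_or_gt κ 0 with h0 | h0
  · refine tendsto_const_nhds.congr' ?_
    filter_upwards [Filter.eventually_gt_atTop 0] with T hT
    symm
    convert! measure_empty (μ := sampleLaw lam T p)
    ext ω
    simp only [mem_ofPred_eq, mem_empty_iff_false, iff_false, not_lt]
    exact (mul_nonpos_of_nonpos_of_nonneg h0 hT.le).trans (Nat.cast_nonneg _)
  have hm : 0 < markProb p c := by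
    by_contra h
    nlinarith [markProb_nonneg p c]
  refine tendsto_of_tendsto_of_tendsto_of_le_of_le' tendsto_const_nhds
    (tendsto_exp_mul_neg (rate_neg (mul_pos hlam hm) h0 hκ.ne)) (by simp) ?_
  filter_upwards [Filter.eventually_gt_atTop 0] with T hT
  refine chernoff_markCount hlam hT p c hm h0 _ fun ω hω => ?_
  exact Real.rpow_le_rpow_of_exponent_ge (by positivity)
    ((div_le_one (by positivity)).2 hκ.le) (le_of_lt hω)

lemma tendsto_lt_markCount {lam κ : ℝ} (hlam : 0 < lam) (p : unitInterval) (c : Bool → Bool)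
    (hm : 0 < markProb p c) (hκ : lam * markProb p c < κ) :
    Filter.Tendsto (fun T : ℝ => sampleLaw lam T p {ω | κ * T < markCount c ω})
      Filter.atTop (nhds 0) := by
  have h0 : 0 < κ := (mul_pos hlam hm).trans hκ
  refine tendsto_of_tendsto_of_tendsto_of_le_of_le' tendsto_const_nhds
    (tendsto_exp_mul_neg (rate_neg (mul_pos hlam hm) h0 hκ.ne')) (by simp) ?_
  filter_upwards [Filter.eventually_gt_atTop 0] with T hT
  refine chernoff_markCount hlam hT p c hm h0 _ fun ω hω => ?_
  exact Real.rpow_le_rpow_of_exponent_le ((one_le_div (by positivity)).2 hκ.le) (le_of_lt hω)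

/-! ### Bounding the number of messages from below -/

/-- Makes conditioning explicit: the unknown positions can be redrawn independently while everything
the reconstructor knows stays fixed. -/
lemma map_resample {X : Type*} [MeasurableSpace X] (μ : Measure X) [IsProbabilityMeasure μ]
    (J : Finset ℕ) :
    ((Measure.infinitePi fun _ : ℕ => μ).prod (Measure.infinitePi fun _ : ℕ => μ)).map
      (fun z i => if i ∈ J then z.2 i else z.1 i) = Measure.infinitePi fun _ : ℕ => μ := by
  have hm : Measurable fun (z : (ℕ → X) × (ℕ → X)) i => if i ∈ J then z.2 i else z.1 i := by
    refine measurable_pi_lambda _ fun i => ?_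
    split_ifs <;> fun_prop
  refine Measure.eq_infinitePi _ fun s t ht => ?_
  have hset : (fun (z : (ℕ → X) × (ℕ → X)) i => if i ∈ J then z.2 i else z.1 i) ⁻¹'
      Set.pi (s : Set ℕ) t = (Set.pi (s \ J : Finset ℕ) t) ×ˢ (Set.pi (s ∩ J : Finset ℕ) t) := by
    ext z
    simp only [mem_preimage, Set.mem_pi, mem_prod, Finset.mem_coe, Finset.mem_sdiff,
      Finset.mem_inter]
    grind
  rw [Measure.map_apply hm (MeasurableSet.pi s.countable_toSet fun i _ => ht i), hset,
    Measure.prod_prod, Measure.infinitePi_pi _ (fun i _ => ht i),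
    Measure.infinitePi_pi _ (fun i _ => ht i)]
  rw [← Finset.prod_inter_mul_prod_sdiff s J, mul_comm]

lemma volume_unitInterval_preimage_le {T : ℝ} (hT : 0 < T) (A : Set ℝ) :
    (volume : Measure unitInterval) {u | T * (u : ℝ) ∈ A} ≤ volume A / ENNReal.ofReal T := by
  rw [show (volume : Measure unitInterval) = Measure.comap Subtype.val volume from rfl,
    (MeasurableEmbedding.subtype_coe measurableSet_Icc).comap_apply]
  refine (measure_mono (t := (fun x => T * x) ⁻¹' A) ?_).trans ?_
  · rintro _ ⟨u, hu, rfl⟩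
    exact hu
  · rw [Real.volume_preimage_mul_left hT.ne', abs_of_pos (by positivity),
      ENNReal.ofReal_inv_of_pos hT, mul_comm, div_eq_mul_inv]

lemma infinitePi_forall_mem_le {T : ℝ} (hT : 0 < T) (A : Set ℝ) (hA : MeasurableSet A)
    (J : Finset ℕ) :
    (Measure.infinitePi fun _ : ℕ => (volume : Measure unitInterval))
      {v | ∀ i ∈ J, T * (v i : ℝ) ∈ A} ≤ (volume A / ENNReal.ofReal T) ^ J.card := by
  have h : {v : ℕ → unitInterval | ∀ i ∈ J, T * (v i : ℝ) ∈ A} =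
      Set.pi (J : Set ℕ) fun _ => {u : unitInterval | T * (u : ℝ) ∈ A} := by
    ext v; simp [Set.mem_pi]
  rw [h, Measure.infinitePi_pi]
  · rw [Finset.prod_const]
    exact pow_le_pow_left' (volume_unitInterval_preimage_le hT A) _
  · intro i _
    exact (measurable_const.mul measurable_subtype_coe) hA

/-- The distortion of an informed code. -/
def informedDistortion {W : ℕ} (T : ℝ) (f : Finset ℝ × Finset ℝ → Fin W)
    (A : Fin W → Finset ℝ → Set ℝ) (ω : Sample) : ℝ≥0∞ :=
  distortion T (points T ω) (A (f (points T ω, knownPoints T ω)) (knownPoints T ω))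

/-- The summand of the message actually sent already dominates. Summing over all messages removes
the dependence of the message on the unknown points. -/
lemma informedDistortion_inv_pow_le {W : ℕ} (T : ℝ) (f : Finset ℝ × Finset ℝ → Fin W)
    (A : Fin W → Finset ℝ → Set ℝ) (ω : Sample) :
    (informedDistortion T f A ω)⁻¹ ^ markCount not ω ≤
      ∑ m, {v : ℕ → unitInterval | ∀ i ∈ (Finset.range ω.1).filter fun i => not (ω.2.2 i) = true,
          T * (v i : ℝ) ∈ toMeasurable volume (A m (knownPoints T ω))}.indicator
        (fun _ => (volume (A m (knownPoints T ω)) / ENNReal.ofReal T)⁻¹ ^ markCount not ω)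
        ω.2.1 := by
  refine le_trans ?_ (Finset.single_le_sum (fun _ _ => zero_le)
    (Finset.mem_univ (f (points T ω, knownPoints T ω))))
  unfold informedDistortion distortion
  split_ifs with h
  · rw [indicator_of_mem]
    intro i hi
    refine subset_toMeasurable _ _ (h ?_)
    simp only [Finset.mem_filter] at hi
    simp only [points, Finset.coe_image, mem_image, Finset.mem_coe]
    exact ⟨i, hi.1, rfl⟩
  -- Infinite distortion: the left side is `0 ^ k`, which is `1` for `k = 0`, but then the indicator
  -- condition is vacuous.
  · rcases Nat.eq_zero_or_pos (markCount not ω) with h0 | h0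
    · rw [indicator_of_mem]
      · simp [h0]
      · intro i hi
        rw [markCount, Finset.card_eq_zero] at h0
        rw [h0] at hi
        simp at hi
    · simp [h0.ne']

/-- After resampling the unknown positions, each message contributes at most `x⁻¹ ^ k * x ^ k ≤ 1`.
Encoder and decoder need not be measurable here: only the inequalities of Fubini and change of
variables that hold for upper integrals are used. -/
lemma lintegral_informedDistortion_inv_pow_le {W : ℕ} {T : ℝ} (hT : 0 < T) (lam : ℝ)
    (p : unitInterval) (f : Finset ℝ × Finset ℝ → Fin W) (A : Fin W → Finset ℝ → Set ℝ) :
    ∫⁻ ω, (informedDistortion T f A ω)⁻¹ ^ markCount not ω ∂sampleLaw lam T p ≤ W := by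
  set G : Sample → ℝ≥0∞ := fun ω => (informedDistortion T f A ω)⁻¹ ^ markCount not ω with hG
  set π := Measure.infinitePi fun _ : ℕ => (volume : Measure unitInterval) with hπ
  set β := Measure.infinitePi fun _ : ℕ => bernoulliMeasure true false p with hβ
  have inner (n : ℕ) (b : ℕ → Bool) (v : ℕ → unitInterval) :
      ∫⁻ v', G (n, (fun i => if i ∈ (Finset.range n).filter fun i => not (b i) = true
        then v' i else v i), b) ∂π ≤ W := by
    set J := (Finset.range n).filter fun i => not (b i) = true with hJ
    have hk (v' : ℕ → unitInterval) :
        knownPoints T (n, (fun i => if i ∈ J then v' i else v i), b) = knownPoints T (n, v, b) := by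
      unfold knownPoints
      refine Finset.image_congr fun i hi => ?_
      have : i ∉ J := by
        simp only [Finset.coe_filter, mem_ofPred_eq] at hi
        simp [hJ, hi.2]
      simp [this]
    set s := knownPoints T (n, v, b)
    set E : Fin W → Set (ℕ → unitInterval) := fun m =>
      {v' | ∀ i ∈ J, T * (v' i : ℝ) ∈ toMeasurable volume (A m s)} with hE
    have hEm (m : Fin W) : MeasurableSet (E m) := by
      have : E m = ⋂ i ∈ J, {v' | T * (v' i : ℝ) ∈ toMeasurable volume (A m s)} := by
        ext; simp [hE]
      rw [this]
      refine Finset.measurableSet_biInter _ fun i _ => ?_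
      have : Measurable fun v' : ℕ → unitInterval => T * (v' i : ℝ) := by fun_prop
      exact this (measurableSet_toMeasurable _ _)
    calc ∫⁻ v', G (n, (fun i => if i ∈ J then v' i else v i), b) ∂π
        ≤ ∫⁻ v', ∑ m, (E m).indicator
            (fun _ => (volume (A m s) / ENNReal.ofReal T)⁻¹ ^ J.card) v' ∂π := by
          refine lintegral_mono fun v' => ?_
          refine (informedDistortion_inv_pow_le T f A _).trans (le_of_eq ?_)
          refine Finset.sum_congr rfl fun m _ => ?_
          rw [hk v']
          simp only [indicator, mem_ofPred_eq, hE, ← hJ, markCount]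
          congr 1
          refine propext (forall₂_congr fun i hi => ?_)
          rw [if_pos hi]
      _ = ∑ m, (volume (A m s) / ENNReal.ofReal T)⁻¹ ^ J.card * π (E m) := by
          rw [lintegral_finsetSum _ fun m _ => measurable_const.indicator (hEm m)]
          refine Finset.sum_congr rfl fun m _ => ?_
          rw [lintegral_indicator_const (hEm m)]
      _ ≤ ∑ m : Fin W, 1 := by
          refine Finset.sum_le_sum fun m _ => ?_
          have := infinitePi_forall_mem_le hT _ (measurableSet_toMeasurable volume (A m s)) J
          rw [measure_toMeasurable] at this
          refine (mul_le_mul_right this _).trans ?_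
          rw [← mul_pow]
          exact pow_le_one' (ENNReal.inv_mul_le_one _) _
      _ = W := by simp
  calc ∫⁻ ω, G ω ∂sampleLaw lam T p
      ≤ ∫⁻ n, ∫⁻ y, G (n, y) ∂(π.prod β) ∂poissonMeasure (lam * T).toNNReal :=
        lintegral_prod_le _
    _ ≤ ∫⁻ _, W ∂poissonMeasure (lam * T).toNNReal := by
        refine lintegral_mono fun n => ?_
        -- Marks go to the outer integral, since the set of coordinates to resample depends on them.
        rw [← Measure.prod_swap]
        refine (lintegral_map_le _ _).trans ((lintegral_prod_le _).trans ?_)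
        calc _ ≤ ∫⁻ _, W ∂β := by
              refine lintegral_mono fun b => ?_
              rw [hπ, ← map_resample _ ((Finset.range n).filter fun i => not (b i) = true)]
              refine (lintegral_map_le _ _).trans ((lintegral_prod_le _).trans ?_)
              refine (lintegral_mono fun v => inner n b v).trans ?_
              simp
          _ = W := by simp
    _ = W := by simp

/-- Tangent-line bound for the convex function `x ↦ x⁻¹ ^ k` at `c`, obtained from Bernoulli's
inequality and `c / x + x / c ≥ 2`. -/
lemma one_add_mul_inv_pow_le {c x : ℝ} (hc : 0 < c) (hx : 0 < x) (k : ℕ) :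
    (1 + k) * (c ^ k)⁻¹ ≤ x⁻¹ ^ k + k * (c ^ k)⁻¹ / c * x := by
  have h1 : 1 + (k : ℝ) * (c / x - 1) ≤ (1 + (c / x - 1)) ^ k :=
    one_add_mul_le_pow (by have := div_pos hc hx; linarith) k
  have h2 : 1 - x / c ≤ c / x - 1 := by
    have h3 : c / x + x / c - 2 = (c - x) ^ 2 / (x * c) := by field_simp; ring
    have : 0 ≤ (c - x) ^ 2 / (x * c) := by positivity
    linarith
  have h3 : (1 + (k : ℝ)) - k * (x / c) ≤ (c / x) ^ k := by
    have := mul_le_mul_of_nonneg_left h2 (Nat.cast_nonneg (α := ℝ) k)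
    rw [add_sub_cancel] at h1
    linarith
  have h4 := mul_le_mul_of_nonneg_right h3 (inv_pos.2 (pow_pos hc k)).le
  have h5 : (c / x) ^ k * (c ^ k)⁻¹ = x⁻¹ ^ k := by
    rw [div_pow, inv_pow]; field_simp
  rw [h5] at h4
  have : k * (c ^ k)⁻¹ / c * x = k * (x / c) * (c ^ k)⁻¹ := by field_simp
  linarith

lemma distortion_le_one_or_eq_top {T : ℝ} (x : Finset ℝ) {A : Set ℝ}
    (hA : A ⊆ Icc 0 T) : distortion T x A ≤ 1 ∨ distortion T x A = ⊤ := by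
  unfold distortion
  split_ifs
  · left
    refine ENNReal.div_le_of_le_mul ?_
    simpa using measure_mono (μ := volume) hA
  · exact Or.inr rfl

lemma indicator_le_inv_pow_add {c : ℝ} (hc : 0 < c) {d : ℝ≥0∞} (hd : d ≤ 1 ∨ d = ⊤)
    {k₀ k : ℕ} (hk₀ : 0 < k₀) (hk : k₀ ≤ k) :
    ENNReal.ofReal ((1 + k₀) * (c ^ k₀)⁻¹) ≤
      d⁻¹ ^ k + ENNReal.ofReal (k₀ * (c ^ k₀)⁻¹ / c) * d := by
  rcases hd with hd | rfl
  · rcases eq_or_ne d 0 with rfl | h0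
    · rw [ENNReal.inv_zero, ENNReal.top_pow (by omega)]
      simp
    have htop : d ≠ ⊤ := (hd.trans_lt ENNReal.one_lt_top).ne
    have h1 : d⁻¹ ^ k₀ ≤ d⁻¹ ^ k := pow_le_pow_right₀ (by simpa using hd) hk
    refine le_trans ?_ (add_le_add_left h1 _)
    have hx := ENNReal.toReal_pos h0 htop
    rw [← ENNReal.ofReal_toReal htop, ← ENNReal.ofReal_inv_of_pos hx,
      ← ENNReal.ofReal_pow (by positivity), ← ENNReal.ofReal_mul (by positivity),
      ← ENNReal.ofReal_add (by positivity) (by positivity)]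
    exact ENNReal.ofReal_le_ofReal (one_add_mul_inv_pow_le hc hx k₀)
  · rw [ENNReal.mul_top]
    · simp
    · simp only [ne_eq, ENNReal.ofReal_eq_zero, not_le]
      positivity

/-- Integrate the tangent-line bound over `k₀ ≤ markCount not`. The coefficients `1 + k₀` and `k₀`
cancel up to one term because the event has probability at least `D / c`. -/
lemma card_message_ge {W : ℕ} {T : ℝ} (hT : 0 < T) {lam : ℝ} {p : unitInterval}
    (f : Finset ℝ × Finset ℝ → Fin W) (A : Fin W → Finset ℝ → Set ℝ)
    (hA : ∀ m s, A m s ⊆ Icc 0 T) {D c : ℝ} (hD : 0 ≤ D) (hc : 0 < c)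
    (hE : ExpectationLE (sampleLaw lam T p) (informedDistortion T f A) D) {k₀ : ℕ} (hk₀ : 0 < k₀)
    (hP : D / c ≤ (sampleLaw lam T p).real {ω | k₀ ≤ markCount not ω}) :
    D / c * (c ^ k₀)⁻¹ ≤ W := by
  set P := sampleLaw lam T p
  set G : Set Sample := {ω | k₀ ≤ markCount not ω} with hG
  have hGm : MeasurableSet G := measurable_markCount not measurableSet_Ici
  set C : ℝ := (c ^ k₀)⁻¹ with hC
  have hCpos : 0 < C := by positivity
  have key : ENNReal.ofReal ((1 + k₀) * C) * P G ≤ W + ENNReal.ofReal (k₀ * C / c) *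
      ENNReal.ofReal D := by
    calc ENNReal.ofReal ((1 + k₀) * C) * P G
        = ∫⁻ ω, G.indicator (fun _ => ENNReal.ofReal ((1 + k₀) * C)) ω ∂P := by
          rw [lintegral_indicator_const hGm]
      _ ≤ ∫⁻ ω, ((informedDistortion T f A ω)⁻¹ ^ markCount not ω +
            ENNReal.ofReal (k₀ * C / c) * informedDistortion T f A ω) ∂P := by
          refine lintegral_mono fun ω => ?_
          by_cases hω : ω ∈ G
          swap
          · simp [indicator_of_notMem hω]
          rw [indicator_of_mem hω]
          exact indicator_le_inv_pow_add hc (distortion_le_one_or_eq_top _ (hA _ _)) hk₀ hω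
      _ = ∫⁻ ω, (informedDistortion T f A ω)⁻¹ ^ markCount not ω ∂P +
            ENNReal.ofReal (k₀ * C / c) * ∫⁻ ω, informedDistortion T f A ω ∂P := by
          rw [lintegral_add_right' _ (hE.1.const_mul _), lintegral_const_mul'' _ hE.1]
      _ ≤ _ := by
          gcongr
          · exact lintegral_informedDistortion_inv_pow_le hT lam p f A
          · exact hE.2
  rw [← ofReal_measureReal (measure_ne_top P G), ← ENNReal.ofReal_mul (by positivity),
    ← ENNReal.ofReal_mul (by positivity), ← ENNReal.ofReal_natCast W,
    ← ENNReal.ofReal_add (by positivity) (by positivity),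
    ENNReal.ofReal_le_ofReal_iff (by positivity)] at key
  have h1 : (1 + k₀) * C * (D / c) ≤ (1 + k₀) * C * P.real G := by gcongr
  have h2 : k₀ * C / c * D = k₀ * C * (D / c) := by field_simp
  linarith

/-! ### The converse -/

/-- At a negative rate the message set is empty, so no encoder exists. -/
lemma InformedAchievable.nonneg {lam R D : ℝ} {p : unitInterval}
    (h : InformedAchievable lam p R D) : 0 ≤ R := by
  by_contra! hR
  obtain ⟨T₀, hT₀, h⟩ := h (-R / 2) (by linarith)
  obtain ⟨f, -⟩ := h (T₀ + 1) (by linarith)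
  have hpos := (Nat.zero_le _).trans_lt (f (∅, ∅)).2
  have h1 : (2 : ℝ) ^ ((T₀ + 1) * (R + -R / 2)) < 1 :=
    Real.rpow_lt_one_of_one_lt_of_neg one_lt_two (by nlinarith)
  rw [(Nat.floor_eq_zero).2 h1] at hpos
  exact lt_irrefl _ hpos

lemma InformedAchievable.le_of_lt {lam R D κ c : ℝ} {p : unitInterval} (hlam : 0 < lam)
    (hD : 0 < D) (h : InformedAchievable lam p R D) (hκ0 : 0 < κ) (hκ : κ < lam * (1 - p))
    (hDc : D < c) (hc1 : c < 1) : κ * (-Real.logb 2 c) ≤ R := by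
  by_contra! hR
  have hc0 : 0 < c := hD.trans hDc
  -- One `ε` is the slack of the code; the second makes the lower bound on the message count exceed
  -- the available number by a factor `2 ^ (ε * T)`, which beats the constant `(D + ε) / c`.
  obtain ⟨ε, hε, hε1, hε2⟩ : ∃ ε > 0, D + ε < c ∧ R + 2 * ε < κ * (-Real.logb 2 c) := by
    refine ⟨min ((c - D) / 2) ((κ * (-Real.logb 2 c) - R) / 3), ?_, ?_, ?_⟩
    · exact lt_min (by linarith) (by linarith)
    · have := min_le_left ((c - D) / 2) ((κ * (-Real.logb 2 c) - R) / 3)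
      linarith
    · have := min_le_right ((c - D) / 2) ((κ * (-Real.logb 2 c) - R) / 3)
      linarith
  obtain ⟨T₀, hT₀, h⟩ := h ε hε
  have hr : 0 < (D + ε) / c := by positivity
  have hr1 : (D + ε) / c < 1 := (div_lt_one hc0).2 hε1
  have hmark : markProb p not = 1 - p := by simp [markProb]
  have hlim := tendsto_markCount_lt hlam p not (κ := κ) (by rwa [hmark])
  have hev : ∀ᶠ T in Filter.atTop, sampleLaw lam T p {ω | (markCount not ω : ℝ) < κ * T} <
      ENNReal.ofReal (1 - (D + ε) / c) :=
    hlim.eventually_lt_const (by simpa using hr1)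
  have hexp : Filter.Tendsto (fun T : ℝ => (2 : ℝ) ^ (-ε * T)) Filter.atTop (nhds 0) :=
    (tendsto_rpow_atBot_of_base_gt_one 2 one_lt_two).comp
      (Filter.tendsto_id.const_mul_atTop_of_neg (neg_lt_zero.2 hε))
  obtain ⟨T, hT1, hT2, hT3, hT4⟩ := (hev.and ((hexp.eventually_lt_const hr).and
    ((Filter.eventually_gt_atTop T₀).and (Filter.eventually_gt_atTop 0)))).exists
  obtain ⟨f, φ, -, hE⟩ := h T hT3
  have hκT : 0 < κ * T := by positivity
  have hP : (D + ε) / c ≤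
      (sampleLaw lam T p).real {ω | ⌈κ * T⌉₊ ≤ markCount not ω} := by
    have hm : MeasurableSet {ω | ⌈κ * T⌉₊ ≤ markCount not ω} :=
      measurable_markCount not measurableSet_Ici
    have hcompl : {ω | ⌈κ * T⌉₊ ≤ markCount not ω}ᶜ = {ω | (markCount not ω : ℝ) < κ * T} := by
      ext ω
      simp
    have h1 := probReal_compl_eq_one_sub (μ := sampleLaw lam T p) hm
    rw [hcompl] at h1
    have h2 : (sampleLaw lam T p).real {ω | (markCount not ω : ℝ) < κ * T} <
        1 - (D + ε) / c := by
      rw [measureReal_def]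
      exact (ENNReal.lt_ofReal_iff_toReal_lt (measure_ne_top _ _)).1 hT1
    linarith
  have hW := card_message_ge hT4 f φ.toFun φ.subset_Icc (by positivity) hc0 hE
    (Nat.ceil_pos.2 hκT) hP
  have hW2 : ((⌊(2 : ℝ) ^ (T * (R + ε))⌋₊ : ℕ) : ℝ) ≤ (2 : ℝ) ^ (T * (R + ε)) :=
    Nat.floor_le (by positivity)
  have hpow : c ^ ⌈κ * T⌉₊ ≤ c ^ (κ * T) := by
    rw [← Real.rpow_natCast]
    exact Real.rpow_le_rpow_of_exponent_ge hc0 hc1.le (Nat.le_ceil _)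
  have hpow2 : c ^ (κ * T) = (2 : ℝ) ^ (Real.logb 2 c * (κ * T)) := by
    rw [Real.rpow_mul zero_le_two, Real.rpow_logb two_pos (by norm_num) hc0]
  have h1 : (D + ε) / c ≤ (2 : ℝ) ^ (T * (R + ε)) * c ^ ⌈κ * T⌉₊ := by
    have := hW.trans hW2
    rwa [← div_eq_mul_inv, div_le_iff₀ (by positivity)] at this
  have h2 : (D + ε) / c ≤ (2 : ℝ) ^ (-ε * T) := by
    refine h1.trans ((mul_le_mul_of_nonneg_left hpow (by positivity)).trans ?_)
    rw [hpow2, ← Real.rpow_add two_pos]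
    refine Real.rpow_le_rpow_of_exponent_le one_le_two ?_
    nlinarith
  linarith

theorem ratePois_le_of_informedAchievable {lam R D : ℝ} {p : unitInterval} (hlam : 0 < lam)
    (hD : 0 < D) (h : InformedAchievable lam p R D) : ratePois D ((1 - p) * lam) ≤ R := by
  unfold ratePois
  split_ifs with hD1
  swap
  · exact h.nonneg
  -- For `p = 1` there is no positive `κ < lam * (1 - p)`, but the claimed rate is then `0`.
  rcases eq_or_lt_of_le p.2.2 with hp | hp
  · simpa [hp] using h.nonneg
  have hp' : 0 < 1 - (p : ℝ) := by linarith
  have h1 (c : ℝ) (hDc : D < c) (hc1 : c < 1) : (lam * (1 - p)) * (-Real.logb 2 c) ≤ R := by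
    have ht : Filter.Tendsto (fun κ : ℝ => κ * (-Real.logb 2 c))
        (nhdsWithin (lam * (1 - p)) (Iio (lam * (1 - p))))
        (nhds ((lam * (1 - p)) * (-Real.logb 2 c))) :=
      ((continuous_id.mul continuous_const).tendsto _).mono_left nhdsWithin_le_nhds
    refine le_of_tendsto ht ?_
    filter_upwards [Ioo_mem_nhdsLT (mul_pos hlam hp')] with κ hκ
    exact h.le_of_lt hlam hD hκ.1 hκ.2 hDc hc1
  have ht : Filter.Tendsto (fun c : ℝ => (lam * (1 - p)) * (-Real.logb 2 c))
      (nhdsWithin D (Ioi D)) (nhds ((lam * (1 - p)) * (-Real.logb 2 D))) :=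
    ((Real.continuousAt_logb (b := 2) hD.ne').neg.const_mul _).tendsto.mono_left nhdsWithin_le_nhds
  refine le_trans (le_of_eq ?_) (le_of_tendsto ht ?_)
  · ring
  · filter_upwards [Ioo_mem_nhdsGT hD1] with c hc
    exact h1 c hc.1 hc.2

lemma WZAchievable.informed {lam R D : ℝ} {p : unitInterval} (h : WZAchievable lam p R D) :
    InformedAchievable lam p R D := by
  intro ε hε
  obtain ⟨T₀, hT₀, h⟩ := h ε hε
  refine ⟨T₀, hT₀, fun T hT => ?_⟩
  obtain ⟨f, φ, hf, hE⟩ := h T hT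
  refine ⟨fun x => f x.1, φ, ?_, hE⟩
  let := patternSigma
  exact hf.comp measurable_fst

/-! ### Random codebooks -/

open Classical in
/-- An index satisfying `P`, if there is one. -/
def selectIndex {K : ℕ} (P : Fin K → Prop) : Option (Fin K) :=
  if h : ∃ j, P j then some h.choose else none

lemma selectIndex_eq_some {K : ℕ} {P : Fin K → Prop} {j : Fin K} (h : selectIndex P = some j) :
    P j := by
  unfold selectIndex at h
  split_ifs at h with h'
  cases h
  exact h'.choose_spec

lemma selectIndex_eq_none {K : ℕ} {P : Fin K → Prop} : selectIndex P = none ↔ ∀ j, ¬ P j := by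
  simp [selectIndex]

/-- With the random codebook `r` and the random hash function `h`, either no codeword satisfies
`X`, or a codeword other than the selected one has the same hash and satisfies `S`. -/
def CodingFailure {C : Type*} {K M : ℕ} (X S : C → Prop) (r : Fin K → C) (h : Fin K → Fin M) :
    Prop :=
  ∀ j, selectIndex (fun i => X (r i)) = some j → ∃ j' ≠ j, h j' = h j ∧ S (r j')

-- The pair `(h, c)` is recovered from `h` with its value at `i` overwritten by `c`, because `h i`
-- can be read off at `j`.
open Classical in
lemma card_hash_eq_mul_le {K M : ℕ} {i j : Fin K} (hij : i ≠ j) :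
    (Finset.univ.filter fun h : Fin K → Fin M => h i = h j).card * M ≤ M ^ K := by
  calc _ = ((Finset.univ.filter fun h : Fin K → Fin M => h i = h j) ×ˢ
        (Finset.univ : Finset (Fin M))).card := by simp
    _ ≤ (Finset.univ : Finset (Fin K → Fin M)).card := by
        refine Finset.card_le_card_of_injOn (fun x => Function.update x.1 i x.2)
          (fun _ _ => Finset.mem_univ _) ?_
        rintro ⟨h, c⟩ hx ⟨h', c'⟩ hx' heq
        simp only [Finset.coe_product, Finset.coe_filter, Finset.mem_univ, true_and,
          Finset.coe_univ, mem_prod, mem_ofPred_eq, mem_univ, and_true] at hx hx' heq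
        have h1 (k : Fin K) (hk : k ≠ i) : h k = h' k := by
          simpa [hk] using congrFun heq k
        have h2 : c = c' := by simpa using congrFun heq i
        refine Prod.ext (funext fun k => ?_) h2
        rcases eq_or_ne k i with rfl | hk
        · change h k = h' k
          rw [hx, hx', h1 _ hij.symm]
        · exact h1 k hk
    _ = M ^ K := by simp

open Classical in
lemma card_codebook_mem_mul_le {C : Type*} [Fintype C] {K : ℕ} (S : C → Prop) (j : Fin K) :
    (Finset.univ.filter fun r : Fin K → C => S (r j)).card * Fintype.card C ≤
      (Finset.univ.filter S).card * Fintype.card C ^ K := by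
  calc _ = ((Finset.univ.filter fun r : Fin K → C => S (r j)) ×ˢ
        (Finset.univ : Finset C)).card := by simp
    _ ≤ ((Finset.univ.filter S) ×ˢ (Finset.univ : Finset (Fin K → C))).card := by
        refine Finset.card_le_card_of_injOn (fun x => (x.1 j, Function.update x.1 j x.2)) ?_ ?_
        · rintro ⟨r, c⟩ hx
          simpa using hx
        · rintro ⟨r, c⟩ - ⟨r', c'⟩ - heq
          simp only [Prod.mk.injEq] at heq
          refine Prod.ext (funext fun k => ?_) (by simpa using congrFun heq.2 j)
          rcases eq_or_ne k j with rfl | hk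
          · exact heq.1
          · simpa [hk] using congrFun heq.2 k
    _ = _ := by simp

open Classical in
lemma card_codebook_forall_not {C : Type*} [Fintype C] (K : ℕ) (X : C → Prop) :
    (Finset.univ.filter fun r : Fin K → C => ∀ j, ¬ X (r j)).card =
      (Finset.univ.filter fun c => ¬ X c).card ^ K := by
  rw [show (Finset.univ.filter fun r : Fin K → C => ∀ j, ¬ X (r j)) =
    Fintype.piFinset fun _ => Finset.univ.filter fun c => ¬ X c by ext; simp,
    Fintype.card_piFinset]
  simp

-- Union bound by counting: either all `K` codewords miss `X`, or some `j'` satisfies `S` and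
-- collides with the selected index. The selection depends on `r` only, so the collision has
-- probability at most `1 / M` for every fixed `r`; no independence between `S (r j')` and the
-- selection is needed.
open Classical in
lemma card_codingFailure_le {C : Type*} [Fintype C] [Nonempty C] {K M : ℕ} (hM : 0 < M)
    (X S : C → Prop) {α β : ℝ}
    (hX : α * Fintype.card C ≤ (Finset.univ.filter X).card)
    (hS : ((Finset.univ.filter S).card : ℝ) ≤ β * Fintype.card C) :
    ∑ x : (Fin K → C) × (Fin K → Fin M), (if CodingFailure X S x.1 x.2 then (1 : ℝ) else 0) ≤
      Fintype.card ((Fin K → C) × (Fin K → Fin M)) * ((1 - α) ^ K + K * β / M) := by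
  have hC : (0 : ℝ) < Fintype.card C := by exact_mod_cast Fintype.card_pos
  have hM' : (0 : ℝ) < M := by exact_mod_cast hM
  have hpt (r : Fin K → C) (h : Fin K → Fin M) :
      (if CodingFailure X S r h then (1 : ℝ) else 0) ≤
        (if ∀ j, ¬ X (r j) then (1 : ℝ) else 0) + ∑ j', (if S (r j') then (1 : ℝ) else 0) *
          (if ∃ j, selectIndex (fun i => X (r i)) = some j ∧ j' ≠ j ∧ h j' = h j then 1 else 0) := by
    split_ifs with h1 h2 h2
    · refine le_add_of_nonneg_right ?_
      exact Finset.sum_nonneg fun _ _ => by positivity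
    · obtain ⟨j, hj⟩ := Option.ne_none_iff_exists'.1 (fun hn => h2 (selectIndex_eq_none.1 hn))
      obtain ⟨j', hne, hh, hS'⟩ := h1 j hj
      rw [zero_add]
      refine le_trans ?_ (Finset.single_le_sum (f := fun j' => (if S (r j') then (1 : ℝ) else 0) *
          (if ∃ j, selectIndex (fun i => X (r i)) = some j ∧ j' ≠ j ∧ h j' = h j then 1 else 0))
          (fun _ _ => by positivity) (Finset.mem_univ j'))
      rw [if_pos hS', if_pos ⟨j, hj, hne, hh⟩, one_mul]
    all_goals
      refine add_nonneg (by norm_num) (Finset.sum_nonneg fun _ _ => by positivity)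
  have hcoll (r : Fin K → C) (j' : Fin K) : ∑ h : Fin K → Fin M,
      (if ∃ j, selectIndex (fun i => X (r i)) = some j ∧ j' ≠ j ∧ h j' = h j then (1 : ℝ) else 0) ≤
      (M : ℝ) ^ K / M := by
    rw [le_div_iff₀ hM', Finset.sum_boole]
    rcases hs : selectIndex (fun i => X (r i)) with _ | j
    · simp
    rcases eq_or_ne j' j with rfl | hne
    · simp
    have := card_hash_eq_mul_le (M := M) hne
    simp only [Option.some.injEq, exists_eq_left', hne, ne_eq, not_false_eq_true, true_and]
    exact_mod_cast this
  have hSsum (j' : Fin K) : ∑ r : Fin K → C, (if S (r j') then (1 : ℝ) else 0) ≤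
      β * (Fintype.card C : ℝ) ^ K := by
    rw [Finset.sum_boole]
    have h1 : ((Finset.univ.filter fun r : Fin K → C => S (r j')).card : ℝ) * Fintype.card C ≤
      (Finset.univ.filter S).card * (Fintype.card C : ℝ) ^ K := by
        exact_mod_cast card_codebook_mem_mul_le S j'
    have h2 := mul_le_mul_of_nonneg_right hS (pow_pos hC K).le
    refine le_of_mul_le_mul_right (h1.trans (h2.trans (le_of_eq ?_))) hC
    ring
  have hnone : ∑ r : Fin K → C, (if ∀ j, ¬ X (r j) then (1 : ℝ) else 0) ≤
      (1 - α) ^ K * (Fintype.card C : ℝ) ^ K := by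
    rw [Finset.sum_boole, card_codebook_forall_not, Nat.cast_pow, ← mul_pow]
    refine pow_le_pow_left₀ (by positivity) ?_ K
    have : ((Finset.univ.filter X).card : ℝ) + (Finset.univ.filter fun c => ¬ X c).card =
        Fintype.card C := by
      exact_mod_cast Finset.card_filter_add_card_filter_not (s := Finset.univ) X
    linarith
  rw [Fintype.sum_prod_type]
  calc _ ≤ ∑ r : Fin K → C, ∑ h : Fin K → Fin M, ((if ∀ j, ¬ X (r j) then (1 : ℝ) else 0) +
          ∑ j', (if S (r j') then (1 : ℝ) else 0) *
          (if ∃ j, selectIndex (fun i => X (r i)) = some j ∧ j' ≠ j ∧ h j' = h j then 1 else 0)) :=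
        Finset.sum_le_sum fun r _ => Finset.sum_le_sum fun h _ => hpt r h
    _ = ∑ r : Fin K → C, ((M : ℝ) ^ K * (if ∀ j, ¬ X (r j) then (1 : ℝ) else 0) +
          ∑ j', (if S (r j') then (1 : ℝ) else 0) * ∑ h : Fin K → Fin M,
          (if ∃ j, selectIndex (fun i => X (r i)) = some j ∧ j' ≠ j ∧ h j' = h j then 1 else 0)) := by
        refine Finset.sum_congr rfl fun r _ => ?_
        rw [Finset.sum_add_distrib, Finset.sum_const, Finset.sum_comm]
        simp only [Finset.card_univ, Fintype.card_fun, Fintype.card_fin, nsmul_eq_mul,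
          Nat.cast_pow, Finset.mul_sum]
    _ ≤ ∑ r : Fin K → C, ((M : ℝ) ^ K * (if ∀ j, ¬ X (r j) then (1 : ℝ) else 0) +
          ∑ j' : Fin K, (if S (r j') then (1 : ℝ) else 0) * ((M : ℝ) ^ K / M)) := by
        gcongr with r _ j' _
        exact hcoll r j'
    _ = (M : ℝ) ^ K * ∑ r : Fin K → C, (if ∀ j, ¬ X (r j) then (1 : ℝ) else 0) +
          (∑ j' : Fin K, ∑ r : Fin K → C, (if S (r j') then (1 : ℝ) else 0)) *
            ((M : ℝ) ^ K / M) := by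
        rw [Finset.sum_add_distrib, ← Finset.mul_sum, Finset.sum_comm, Finset.sum_mul]
        simp only [Finset.sum_mul]
    _ ≤ (M : ℝ) ^ K * ((1 - α) ^ K * (Fintype.card C : ℝ) ^ K) +
          (∑ j' : Fin K, β * (Fintype.card C : ℝ) ^ K) * ((M : ℝ) ^ K / M) := by
        gcongr with j' _
        exact hSsum j'
    _ = _ := by
        simp only [Finset.sum_const, Finset.card_univ, Fintype.card_fin, nsmul_eq_mul,
          Fintype.card_prod, Fintype.card_fun, Nat.cast_mul, Nat.cast_pow]
        field_simp

/-- The cell `z` (a large cell and a small cell in it) belongs to the set described by the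
codeword `r`, which takes `a` cyclically consecutive small cells in each large cell. -/
def Covers {N q : ℕ} (a : ℕ) (r : Fin N → Fin q) (z : Fin N × Fin q) : Prop :=
  (z.2 - r z.1).val < a

lemma card_fin_sub_val_lt {q : ℕ} [NeZero q] {a : ℕ} (ha : a ≤ q) (u : Fin q) :
    (Finset.univ.filter fun w : Fin q => (u - w).val < a).card = a := by
  have : (Finset.univ.filter fun w : Fin q => (u - w).val < a) =
      (Finset.univ.filter fun v : Fin q => v.val < a).map (Equiv.subLeft u).toEmbedding := by
    ext w
    simp only [Finset.mem_filter, Finset.mem_univ, true_and, Finset.mem_map_equiv]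
    simp [Equiv.subLeft, sub_eq_add_neg, add_comm]
  rw [this, Finset.card_map, Fin.card_filter_val_lt, min_eq_right ha]

lemma card_fin_val_sub_lt {q : ℕ} [NeZero q] {a : ℕ} (ha : a ≤ q) (w : Fin q) :
    (Finset.univ.filter fun u : Fin q => (u - w).val < a).card = a := by
  have : (Finset.univ.filter fun u : Fin q => (u - w).val < a) =
      (Finset.univ.filter fun v : Fin q => v.val < a).map (Equiv.addRight w).toEmbedding := by
    ext u
    simp only [Finset.mem_filter, Finset.mem_univ, true_and, Finset.mem_map_equiv]
    simp [sub_eq_add_neg]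
  rw [this, Finset.card_map, Fin.card_filter_val_lt, min_eq_right ha]

-- Points in distinct large cells constrain distinct coordinates of `r`, each satisfied by exactly
-- `a` of the `q` shifts.
open Classical in
lemma card_covers {N q : ℕ} [NeZero q] {a : ℕ} (ha : a ≤ q) {ι : Type*} (J : Finset ι)
    (z : ι → Fin N × Fin q) (hz : InjOn (fun j => (z j).1) J) :
    ((Finset.univ.filter fun r : Fin N → Fin q => ∀ j ∈ J, Covers a r (z j)).card : ℝ) =
      ((a : ℝ) / q) ^ J.card * Fintype.card (Fin N → Fin q) := by
  have hq : (q : ℝ) ≠ 0 := by exact_mod_cast NeZero.ne q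
  set t : Fin N → Finset (Fin q) := fun i =>
    Finset.univ.filter fun w => ∀ j ∈ J, (z j).1 = i → ((z j).2 - w).val < a with ht
  have hset : (Finset.univ.filter fun r : Fin N → Fin q => ∀ j ∈ J, Covers a r (z j)) =
      Fintype.piFinset t := by
    ext r
    simp only [Finset.mem_filter, Finset.mem_univ, true_and, Fintype.mem_piFinset, ht]
    constructor
    · rintro h _ j hj rfl
      exact h j hj
    · intro h j hj
      exact h _ j hj rfl
  set I := J.image fun j => (z j).1 with hI
  have hIc : I.card = J.card := Finset.card_image_of_injOn hz
  have htc (i : Fin N) : ((t i).card : ℝ) = (if i ∈ I then (a : ℝ) / q else 1) * q := by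
    split_ifs with hi
    · obtain ⟨j, hj, rfl⟩ := Finset.mem_image.1 hi
      have : t (z j).1 = Finset.univ.filter fun w => ((z j).2 - w).val < a := by
        refine Finset.filter_congr fun w _ => ⟨fun h => h j hj rfl, fun h j' hj' he => ?_⟩
        rwa [hz hj' hj he]
      rw [this, card_fin_sub_val_lt ha]
      field_simp
    · have : t i = Finset.univ := by
        refine Finset.filter_true_of_mem fun w _ j hj he => ?_
        exact absurd (Finset.mem_image.2 ⟨j, hj, he⟩) hi
      rw [this]
      simp
  rw [hset, Fintype.card_piFinset, Nat.cast_prod, Finset.prod_congr rfl fun i _ => htc i,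
    Finset.prod_mul_distrib, Finset.prod_ite]
  simp [hIc, div_pow]

open Classical in
lemma card_covered_cells {N q : ℕ} [NeZero q] {a : ℕ} (ha : a ≤ q) (r : Fin N → Fin q) :
    (Finset.univ.filter fun z : Fin N × Fin q => Covers a r z).card = N * a := by
  rw [Finset.card_filter, Fintype.sum_prod_type]
  have (i : Fin N) : ∑ u : Fin q, (if Covers a r (i, u) then 1 else 0) = a := by
    rw [← Finset.card_filter]
    refine Eq.trans ?_ (card_fin_val_sub_lt ha (r i))
    congr
  simp [this]

/-! ### Codewords as subsets of the interval -/

/-- The index of `x` in the partition of `(0, T]` into `N * q` half-open intervals of equal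
length. -/
def cellIndex (T : ℝ) (N q : ℕ) (x : ℝ) : ℕ := ⌈N * q * x / T⌉₊ - 1

/-- The large cell and the small cell in it that contain `x`, for a partition of `[0, T]` into `N`
large cells, each of them cut into `q` small ones. -/
def cell (T : ℝ) (N q : ℕ) [NeZero N] [NeZero q] (x : ℝ) : Fin N × Fin q :=
  (Fin.ofNat N (cellIndex T N q x / q), Fin.ofNat q (cellIndex T N q x))

lemma measurable_cell (T : ℝ) (N q : ℕ) [NeZero N] [NeZero q] : Measurable (cell T N q) := by
  have h1 : Measurable fun x : ℝ => ⌈N * q * x / T⌉₊ :=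
    Nat.measurable_ceil.comp (by fun_prop)
  exact (measurable_of_countable (fun k : ℕ =>
    ((Fin.ofNat N ((k - 1) / q), Fin.ofNat q (k - 1)) : Fin N × Fin q))).comp h1

lemma volume_cell_fiber_le {T : ℝ} (hT : 0 < T) (N q : ℕ) [NeZero N] [NeZero q]
    (z : Fin N × Fin q) :
    volume {x ∈ Icc 0 T | cell T N q x = z} ≤ ENNReal.ofReal (T / (N * q)) := by
  have hN : (0 : ℝ) < N := by exact_mod_cast NeZero.pos N
  have hq : (0 : ℝ) < q := by exact_mod_cast NeZero.pos q
  set k : ℕ := z.1.val * q + z.2.val with hk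
  have hsub : {x ∈ Icc 0 T | cell T N q x = z} ⊆
      Icc (k * (T / (N * q))) ((k + 1) * (T / (N * q))) := by
    rintro x ⟨⟨hx0, hxT⟩, hz⟩
    set y : ℝ := N * q * x / T with hy
    have hxy : x = y * (T / (N * q)) := by rw [hy]; field_simp
    have hyN : y ≤ (N * q : ℕ) := by
      rw [hy, div_le_iff₀ hT]; push_cast; gcongr
    have hy0 : 0 ≤ y := by positivity
    have hlt : cellIndex T N q x < N * q := by
      have h1 : ⌈y⌉₊ ≤ N * q := Nat.ceil_le.2 hyN
      have h2 : 0 < N * q := Nat.mul_pos (NeZero.pos N) (NeZero.pos q)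
      change ⌈y⌉₊ - 1 < N * q
      omega
    have hkc : cellIndex T N q x = k := by
      have h1 : z.1.val = cellIndex T N q x / q := by
        rw [← hz]
        exact Nat.mod_eq_of_lt (Nat.div_lt_of_lt_mul (by rwa [mul_comm]))
      have h2 : z.2.val = cellIndex T N q x % q := by rw [← hz]; rfl
      rw [hk, h1, h2]
      exact (Nat.div_add_mod' _ _).symm
    have hk1 : (k : ℝ) ≤ y ∧ y ≤ k + 1 := by
      rw [← hkc]
      unfold cellIndex
      rw [← hy]
      -- At `x = 0` the truncated subtraction puts the endpoint into the first cell.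
      rcases Nat.eq_zero_or_pos ⌈y⌉₊ with h0 | h0
      · rw [h0]
        have := Nat.ceil_eq_zero.1 h0
        simp only [zero_tsub, CharP.cast_eq_zero, zero_add]
        constructor <;> linarith
      · rw [Nat.cast_sub h0]
        have h1 := Nat.ceil_lt_add_one hy0
        have h2 := Nat.le_ceil y
        push_cast
        constructor <;> linarith
    rw [hxy]
    exact ⟨by gcongr; exact hk1.1, by gcongr; exact hk1.2⟩
  refine (measure_mono hsub).trans (le_of_eq ?_)
  rw [Real.volume_Icc]
  congr 1
  ring

lemma volume_cell_mem_le {T : ℝ} (hT : 0 < T) (N q : ℕ) [NeZero N] [NeZero q]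
    (B : Finset (Fin N × Fin q)) :
    volume {x ∈ Icc 0 T | cell T N q x ∈ B} ≤ ENNReal.ofReal (B.card * (T / (N * q))) := by
  have : {x ∈ Icc 0 T | cell T N q x ∈ B} = ⋃ z ∈ B, {x ∈ Icc 0 T | cell T N q x = z} := by
    ext x; simp
  rw [this]
  refine (measure_biUnion_finset_le _ _).trans
    ((Finset.sum_le_sum fun z _ => volume_cell_fiber_le hT N q z).trans ?_)
  rw [Finset.sum_const, ENNReal.ofReal_mul (by positivity)]
  simp

/-- The subset of `[0, T]` described by the codeword `r`. -/
def codeSet (T : ℝ) {N q : ℕ} [NeZero N] [NeZero q] (a : ℕ) (r : Fin N → Fin q) : Set ℝ :=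
  {x ∈ Icc 0 T | Covers a r (cell T N q x)}

lemma measurableSet_codeSet (T : ℝ) {N q : ℕ} [NeZero N] [NeZero q] (a : ℕ) (r : Fin N → Fin q) :
    MeasurableSet (codeSet T a r) :=
  measurableSet_Icc.inter (measurable_cell T N q (MeasurableSet.of_discrete (s := {z | Covers a r z})))

lemma volume_codeSet_le {T : ℝ} (hT : 0 < T) {N q : ℕ} [NeZero N] [NeZero q] {a : ℕ}
    (ha : a ≤ q) (r : Fin N → Fin q) :
    volume (codeSet T a r) ≤ ENNReal.ofReal ((a : ℝ) / q * T) := by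
  classical
  have hN : (0 : ℝ) < N := by exact_mod_cast NeZero.pos N
  have h := volume_cell_mem_le hT N q (Finset.univ.filter fun z : Fin N × Fin q => Covers a r z)
  rw [card_covered_cells ha] at h
  simp only [Finset.mem_filter, Finset.mem_univ, true_and] at h
  refine h.trans (le_of_eq ?_)
  congr 1
  push_cast
  field_simp

/-- Two of the first `n` positions lie in the same large cell. -/
def Collision (T : ℝ) (N q : ℕ) [NeZero N] [NeZero q] (n : ℕ) (v : ℕ → unitInterval) : Prop :=
  ∃ i < n, ∃ j < n, i ≠ j ∧ (cell T N q (T * v i)).1 = (cell T N q (T * v j)).1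

lemma mul_mem_Icc {T : ℝ} (hT : 0 < T) (u : unitInterval) : T * (u : ℝ) ∈ Icc 0 T :=
  ⟨mul_nonneg hT.le u.2.1, mul_le_of_le_one_right hT.le u.2.2⟩

/-- Union bound over pairs of positions and over cells: at most `n ^ 2 * N * (1 / N) ^ 2`. -/
lemma infinitePi_collision_le {T : ℝ} (hT : 0 < T) (N q : ℕ) [NeZero N] [NeZero q] (n : ℕ) :
    (Measure.infinitePi fun _ : ℕ => (volume : Measure unitInterval))
      {v | Collision T N q n v} ≤ ENNReal.ofReal ((n : ℝ) ^ 2 / N) := by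
  classical
  have hN : (0 : ℝ) < N := by exact_mod_cast NeZero.pos N
  have hq : (0 : ℝ) < q := by exact_mod_cast NeZero.pos q
  set A : Fin N → Set ℝ := fun c => {x ∈ Icc 0 T | (cell T N q x).1 = c} with hA
  have hAm (c : Fin N) : MeasurableSet (A c) := measurableSet_Icc.inter
    (measurable_cell T N q (MeasurableSet.of_discrete (s := {z : Fin N × Fin q | z.1 = c})))
  have hAv (c : Fin N) : volume (A c) / ENNReal.ofReal T ≤ ENNReal.ofReal (1 / N) := by
    have h := volume_cell_mem_le hT N q (({c} : Finset (Fin N)) ×ˢ Finset.univ)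
    simp only [Finset.mem_product, Finset.mem_singleton, Finset.mem_univ, and_true,
      Finset.card_product, Finset.card_singleton, Finset.card_univ, Fintype.card_fin, one_mul] at h
    refine (ENNReal.div_le_div_right h _).trans (le_of_eq ?_)
    rw [← ENNReal.ofReal_div_of_pos hT]
    congr 1
    field_simp
  have hsub : {v | Collision T N q n v} ⊆ ⋃ x ∈ (Finset.range n ×ˢ Finset.range n).filter
      fun x => x.1 ≠ x.2, ⋃ c ∈ (Finset.univ : Finset (Fin N)),
        {v : ℕ → unitInterval | ∀ i ∈ ({x.1, x.2} : Finset ℕ), T * (v i : ℝ) ∈ A c} := by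
    rintro v ⟨i, hi, j, hj, hij, h⟩
    simp only [mem_iUnion]
    refine ⟨(i, j), by simp [hi, hj, hij], (cell T N q (T * v i)).1, Finset.mem_univ _, ?_⟩
    simp [hA, mul_mem_Icc hT, -mem_Icc, h]
  refine (measure_mono hsub).trans ((measure_biUnion_finset_le _ _).trans ?_)
  calc _ ≤ ∑ x ∈ (Finset.range n ×ˢ Finset.range n).filter fun x => x.1 ≠ x.2,
        ENNReal.ofReal (1 / N) := by
        refine Finset.sum_le_sum fun x hx => ?_
        refine (measure_biUnion_finset_le _ _).trans ?_
        calc _ ≤ ∑ c : Fin N, ENNReal.ofReal (1 / N) ^ 2 := by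
              refine Finset.sum_le_sum fun c _ => ?_
              refine (infinitePi_forall_mem_le hT _ (hAm c) _).trans ?_
              rw [Finset.card_pair (Finset.mem_filter.1 hx).2]
              exact pow_le_pow_left' (hAv c) 2
          _ = ENNReal.ofReal (1 / N) := by
              rw [Finset.sum_const, ← ENNReal.ofReal_pow (by positivity), nsmul_eq_mul,
                ← ENNReal.ofReal_natCast, ← ENNReal.ofReal_mul (by positivity)]
              congr 1
              simp only [Finset.card_univ, Fintype.card_fin]
              field_simp
    _ ≤ ∑ x ∈ Finset.range n ×ˢ Finset.range n, ENNReal.ofReal (1 / N) :=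
        Finset.sum_le_sum_of_subset (Finset.filter_subset _ _)
    _ = _ := by
        rw [Finset.sum_const, nsmul_eq_mul, ← ENNReal.ofReal_natCast,
          ← ENNReal.ofReal_mul (by positivity)]
        congr 1
        simp
        ring

lemma sampleLaw_collision_le {T : ℝ} (hT : 0 < T) (lam : ℝ) (p : unitInterval) (N q : ℕ)
    [NeZero N] [NeZero q] (n : ℕ) :
    sampleLaw lam T p {ω | Collision T N q n ω.2.1} ≤ ENNReal.ofReal ((n : ℝ) ^ 2 / N) := by
  have hmp : MeasurePreserving (fun ω : Sample => ω.2.1) (sampleLaw lam T p)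
      (Measure.infinitePi fun _ : ℕ => (volume : Measure unitInterval)) :=
    measurePreserving_fst.comp measurePreserving_snd
  calc _ ≤ sampleLaw lam T p ((fun ω : Sample => ω.2.1) ⁻¹'
        toMeasurable (Measure.infinitePi fun _ : ℕ => (volume : Measure unitInterval))
          {v | Collision T N q n v}) :=
        measure_mono (preimage_mono (subset_toMeasurable _ _))
    _ = _ := by
        rw [hmp.measure_preimage (measurableSet_toMeasurable _ _).nullMeasurableSet,
          measure_toMeasurable]
    _ ≤ _ := infinitePi_collision_le hT N q n

lemma points_subset_iff (T : ℝ) (ω : Sample) (A : Set ℝ) :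
    (points T ω : Set ℝ) ⊆ A ↔ ∀ i ∈ Finset.range ω.1, T * (ω.2.1 i : ℝ) ∈ A := by
  simp [points, subset_def]

lemma knownPoints_subset_iff (T : ℝ) (ω : Sample) (A : Set ℝ) :
    (knownPoints T ω : Set ℝ) ⊆ A ↔
      ∀ i ∈ (Finset.range ω.1).filter fun i => ω.2.2 i = true, T * (ω.2.1 i : ℝ) ∈ A := by
  simp only [knownPoints, Finset.coe_image, image_subset_iff]
  rfl

lemma measurableSet_forall_mem (T : ℝ) {A : Set ℝ} (hA : MeasurableSet A) (c : Bool → Bool) :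
    MeasurableSet {ω : Sample |
      ∀ i ∈ (Finset.range ω.1).filter fun i => c (ω.2.2 i) = true, T * (ω.2.1 i : ℝ) ∈ A} := by
  have : {ω : Sample |
      ∀ i ∈ (Finset.range ω.1).filter fun i => c (ω.2.2 i) = true, T * (ω.2.1 i : ℝ) ∈ A} =
      ⋂ i : ℕ, ({ω | ω.1 ≤ i} ∪ {ω | c (ω.2.2 i) = false} ∪ {ω | T * (ω.2.1 i : ℝ) ∈ A}) := by
    ext ω
    simp only [mem_ofPred_eq, Finset.mem_filter, Finset.mem_range, mem_iInter, mem_union]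
    grind
  rw [this]
  refine MeasurableSet.iInter fun i => (MeasurableSet.union ?_ ?_).union ?_
  · exact measurable_fst measurableSet_Iic
  · have : Measurable fun ω : Sample => ω.2.2 i :=
      (measurable_pi_apply i).comp measurable_snd.snd
    exact this (MeasurableSet.of_discrete (s := {b | c b = false}))
  · have : Measurable fun ω : Sample => T * (ω.2.1 i : ℝ) := by fun_prop
    exact this hA

lemma measurableSet_points_subset (T : ℝ) {A : Set ℝ} (hA : MeasurableSet A) :
    MeasurableSet {ω : Sample | (points T ω : Set ℝ) ⊆ A} := by
  simp_rw [points_subset_iff]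
  simpa using measurableSet_forall_mem T hA fun _ => true

lemma measurableSet_knownPoints_subset (T : ℝ) {A : Set ℝ} (hA : MeasurableSet A) :
    MeasurableSet {ω : Sample | (knownPoints T ω : Set ℝ) ⊆ A} := by
  simp_rw [knownPoints_subset_iff]
  exact measurableSet_forall_mem T hA id

lemma measurableSet_pattern_subset {A : Set ℝ} (hA : MeasurableSet A) :
    MeasurableSet[patternSigma] {x : Finset ℝ | (x : Set ℝ) ⊆ A} := by
  have h : {x : Finset ℝ | (x : Set ℝ) ⊆ A} =
      (fun x : Finset ℝ => ((x : Set ℝ) ∩ Aᶜ).ncard) ⁻¹' {0} := by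
    ext x
    simp only [mem_ofPred_eq, mem_preimage, mem_singleton_iff]
    rw [ncard_eq_zero (x.finite_toSet.inter_of_left _), ← sdiff_eq, sdiff_eq_empty]
  rw [h]
  exact le_iSup₂ (f := fun (B : Set ℝ) (_ : MeasurableSet B) =>
    MeasurableSpace.comap (fun x : Finset ℝ => ((x : Set ℝ) ∩ B).ncard) ⊤) Aᶜ hA.compl _
    ⟨{0}, trivial, rfl⟩

/-! ### The code -/

section Code

variable {K M : ℕ} (T : ℝ) (B : Fin K → Set ℝ) (h : Fin K → Fin M)

/-- The encoder sends the hash of the selected codeword that covers the pattern, or reports that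
there is none. -/
def encode (x : Finset ℝ) : Option (Fin M) :=
  (selectIndex fun j => (x : Set ℝ) ⊆ B j).map h

/-- The reconstruction from the message and from the codewords that cover the known points. -/
def decodeAux (m : Option (Fin M)) (P : Fin K → Prop) : Set ℝ :=
  m.elim (Icc 0 T) fun m => ⋃ (j : Fin K) (_ : h j = m ∧ P j), B j

/-- The reconstruction from the message and the known points. -/
def decode (m : Option (Fin M)) (s : Finset ℝ) : Set ℝ :=
  decodeAux T B h m fun j => (s : Set ℝ) ⊆ B j

variable {T B h}

lemma decode_subset (hB : ∀ j, B j ⊆ Icc 0 T) (m : Option (Fin M)) (s : Finset ℝ) :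
    decode T B h m s ⊆ Icc 0 T := by
  unfold decode decodeAux
  cases m
  · exact subset_rfl
  · exact iUnion₂_subset fun j _ => hB j

lemma measurableSet_decode (hB : ∀ j, MeasurableSet (B j)) (m : Option (Fin M)) (s : Finset ℝ) :
    MeasurableSet (decode T B h m s) := by
  unfold decode decodeAux
  cases m
  · exact measurableSet_Icc
  · exact MeasurableSet.iUnion fun j => MeasurableSet.iUnion fun _ => hB j

/-- The selected codeword covers `s ⊆ x` and has the transmitted hash, so it is among the candidates
whose union is output. This is why the distortion is never infinite. -/
lemma subset_decode_encode {x s : Finset ℝ} (hsx : s ⊆ x) (hx : (x : Set ℝ) ⊆ Icc 0 T) :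
    (x : Set ℝ) ⊆ decode T B h (encode B h x) s := by
  unfold decode decodeAux encode
  rcases hs : selectIndex fun j => (x : Set ℝ) ⊆ B j with _ | j
  · exact hx
  · have hj := selectIndex_eq_some hs
    exact hj.trans (subset_iUnion₂_of_subset j
      ⟨rfl, (Finset.coe_subset.2 hsx).trans hj⟩ subset_rfl)

lemma knownPoints_subset_points (T : ℝ) (ω : Sample) : knownPoints T ω ⊆ points T ω :=
  Finset.image_subset_image (Finset.filter_subset _ _)

lemma points_subset_Icc (hT : 0 < T) (ω : Sample) : (points T ω : Set ℝ) ⊆ Icc 0 T :=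
  (points_subset_iff T ω _).2 fun _ _ => mul_mem_Icc hT _

lemma distortion_decode_encode (hT : 0 < T) (ω : Sample) :
    distortion T (points T ω) (decode T B h (encode B h (points T ω)) (knownPoints T ω)) =
      volume (decode T B h (encode B h (points T ω)) (knownPoints T ω)) / ENNReal.ofReal T :=
  if_pos (subset_decode_encode (knownPoints_subset_points T ω) (points_subset_Icc hT ω))

lemma measurable_subset_pattern (hB : ∀ j, MeasurableSet (B j)) :
    Measurable[patternSigma] fun (x : Finset ℝ) (j : Fin K) => (x : Set ℝ) ⊆ B j := by
  let := patternSigma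
  exact measurable_pi_lambda _ fun j => measurable_to_prop (by
    simpa using measurableSet_pattern_subset (hB j))

lemma measurable_encode {β : Type*} (hB : ∀ j, MeasurableSet (B j)) (e : Option (Fin M) → β) :
    Measurable[patternSigma, ⊤] fun x => e (encode B h x) := by
  let := patternSigma
  let : MeasurableSpace β := ⊤
  exact (measurable_of_countable fun P : Fin K → Prop => e ((selectIndex P).map h)).comp
    (measurable_subset_pattern hB)

lemma measurable_distortion (hT : 0 < T) (hB : ∀ j, MeasurableSet (B j)) :
    Measurable fun ω => distortion T (points T ω)
      (decode T B h (encode B h (points T ω)) (knownPoints T ω)) := by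
  simp_rw [distortion_decode_encode hT]
  have h1 : Measurable fun (ω : Sample) (j : Fin K) => (points T ω : Set ℝ) ⊆ B j :=
    measurable_pi_lambda _ fun j => measurable_to_prop (by
      simpa using measurableSet_points_subset T (hB j))
  have h2 : Measurable fun (ω : Sample) (j : Fin K) => (knownPoints T ω : Set ℝ) ⊆ B j :=
    measurable_pi_lambda _ fun j => measurable_to_prop (by
      simpa using measurableSet_knownPoints_subset T (hB j))
  exact (measurable_of_countable fun P : (Fin K → Prop) × (Fin K → Prop) =>
    volume (decodeAux T B h ((selectIndex P.1).map h) P.2) / ENNReal.ofReal T).comp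
    (h1.prodMk h2)

lemma distortion_le_one (hT : 0 < T) (hBT : ∀ j, B j ⊆ Icc 0 T) (ω : Sample) :
    distortion T (points T ω)
      (decode T B h (encode B h (points T ω)) (knownPoints T ω)) ≤ 1 := by
  rw [distortion_decode_encode hT]
  refine ENNReal.div_le_of_le_mul ?_
  simpa using measure_mono (μ := volume) (decode_subset hBT (encode B h (points T ω))
    (knownPoints T ω))

open Classical in
lemma distortion_le_add_failure (hT : 0 < T) (hBT : ∀ j, B j ⊆ Icc 0 T) {d : ℝ} (hd : 0 ≤ d)
    (hBv : ∀ j, volume (B j) ≤ ENNReal.ofReal (d * T)) (ω : Sample) :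
    distortion T (points T ω)
      (decode T B h (encode B h (points T ω)) (knownPoints T ω)) ≤
      ENNReal.ofReal (d + if CodingFailure (fun A : Set ℝ => (points T ω : Set ℝ) ⊆ A)
        (fun A => (knownPoints T ω : Set ℝ) ⊆ A) B h then 1 else 0) := by
  split_ifs with hf
  · refine (distortion_le_one hT hBT ω).trans ?_
    rw [← ENNReal.ofReal_one]
    exact ENNReal.ofReal_le_ofReal (by linarith)
  rw [distortion_decode_encode hT]
  unfold CodingFailure at hf
  push Not at hf
  obtain ⟨j, hj, hu⟩ := hf
  have hsub : decode T B h (encode B h (points T ω)) (knownPoints T ω) ⊆ B j := by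
    unfold decode decodeAux encode
    rw [hj]
    refine iUnion₂_subset fun j' hj' => ?_
    rcases eq_or_ne j' j with rfl | hne
    · exact subset_rfl
    · exact absurd hj'.2 (hu j' hne hj'.1)
  refine ENNReal.div_le_of_le_mul ((measure_mono hsub).trans ((hBv j).trans (le_of_eq ?_)))
  rw [ENNReal.ofReal_mul hd, add_zero]

end Code

/-! ### Achievability -/

/-- The outcomes with more than `n₁` points, with fewer than `s₀` known points, or with two of the
first `n₁` positions in the same large cell. -/
def atypical (T : ℝ) (N q : ℕ) [NeZero N] [NeZero q] (n₁ s₀ : ℕ) : Set Sample :=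
  {ω | n₁ < ω.1} ∪ {ω | markCount id ω < s₀} ∪ {ω | Collision T N q n₁ ω.2.1}

-- Off the atypical set all points lie in distinct large cells, so `card_covers` supplies `α = d ^
-- n₁` and `β = d ^ s₀` for `d = a / q`.
open Classical in
lemma sum_codingFailure_le {T : ℝ} (hT : 0 < T) {N q : ℕ} [NeZero N] [NeZero q] (K : ℕ)
    {M a n₁ s₀ : ℕ} (hM : 0 < M) (ha : a ≤ q) {ω : Sample} (hω : ω ∉ atypical T N q n₁ s₀) :
    ∑ x : (Fin K → Fin N → Fin q) × (Fin K → Fin M),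
      (if CodingFailure (fun A : Set ℝ => (points T ω : Set ℝ) ⊆ A)
        (fun A => (knownPoints T ω : Set ℝ) ⊆ A) (fun j => codeSet T a (x.1 j)) x.2
        then (1 : ℝ) else 0) ≤
      Fintype.card ((Fin K → Fin N → Fin q) × (Fin K → Fin M)) *
        ((1 - ((a : ℝ) / q) ^ n₁) ^ K + K * ((a : ℝ) / q) ^ s₀ / M) := by
  have hq : (0 : ℝ) < q := by exact_mod_cast NeZero.pos q
  have hd0 : 0 ≤ (a : ℝ) / q := by positivity
  have hd1 : (a : ℝ) / q ≤ 1 := (div_le_one hq).2 (by exact_mod_cast ha)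
  unfold atypical at hω
  simp only [mem_union, mem_ofPred_eq, not_or, not_lt] at hω
  obtain ⟨⟨hn, hs⟩, hcol⟩ := hω
  have hinj : InjOn (fun i => (cell T N q (T * (ω.2.1 i : ℝ))).1) (Finset.range ω.1) := by
    intro i hi j hj hij
    simp only [Finset.coe_range, mem_Iio] at hi hj
    by_contra hne
    exact hcol ⟨i, hi.trans_le hn, j, hj.trans_le hn, hne, hij⟩
  have hpts (r : Fin N → Fin q) : (points T ω : Set ℝ) ⊆ codeSet T a r ↔
      ∀ i ∈ Finset.range ω.1, Covers a r (cell T N q (T * (ω.2.1 i : ℝ))) := by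
    rw [points_subset_iff]
    exact forall₂_congr fun i _ => and_iff_right (mul_mem_Icc hT _)
  have hkn (r : Fin N → Fin q) : (knownPoints T ω : Set ℝ) ⊆ codeSet T a r ↔
      ∀ i ∈ (Finset.range ω.1).filter fun i => ω.2.2 i = true,
        Covers a r (cell T N q (T * (ω.2.1 i : ℝ))) := by
    rw [knownPoints_subset_iff]
    exact forall₂_congr fun i _ => and_iff_right (mul_mem_Icc hT _)
  refine card_codingFailure_le (C := Fin N → Fin q) hM
    (fun r => (points T ω : Set ℝ) ⊆ codeSet T a r)
    (fun r => (knownPoints T ω : Set ℝ) ⊆ codeSet T a r) ?_ ?_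
  · simp_rw [hpts]
    rw [card_covers ha _ _ hinj, Finset.card_range]
    gcongr ?_ * _
    exact pow_le_pow_of_le_one hd0 hd1 hn
  · simp_rw [hkn]
    rw [card_covers ha _ _ (hinj.mono (Finset.coe_subset.2 (Finset.filter_subset _ _)))]
    gcongr ?_ * _
    exact pow_le_pow_of_le_one hd0 hd1 hs

/-- Averaging over all codebooks and hash functions: some choice does at least as well as the mean.
Atypical outcomes enter with distortion at most `1`. -/
lemma exists_code {T : ℝ} (hT : 0 < T) (lam : ℝ) (p : unitInterval) (N q : ℕ) [NeZero N]
    [NeZero q] (K : ℕ) {M a n₁ s₀ : ℕ} (hM : 0 < M) (ha : a ≤ q) :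
    ∃ (r : Fin K → Fin N → Fin q) (h : Fin K → Fin M),
      ∫⁻ ω, distortion T (points T ω)
        (decode T (fun j => codeSet T a (r j)) h
          (encode (fun j => codeSet T a (r j)) h (points T ω)) (knownPoints T ω))
          ∂sampleLaw lam T p ≤
      ENNReal.ofReal ((a : ℝ) / q + ((1 - ((a : ℝ) / q) ^ n₁) ^ K + K * ((a : ℝ) / q) ^ s₀ / M)) +
        sampleLaw lam T p (atypical T N q n₁ s₀) := by
  classical
  set d : ℝ := (a : ℝ) / q with hd
  have hd0 : 0 ≤ d := by positivity
  set η : ℝ := (1 - d ^ n₁) ^ K + K * d ^ s₀ / M with hη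
  set F : (Fin K → Fin N → Fin q) × (Fin K → Fin M) → Sample → ℝ≥0∞ := fun x ω =>
    distortion T (points T ω)
      (decode T (fun j => codeSet T a (x.1 j)) x.2
        (encode (fun j => codeSet T a (x.1 j)) x.2 (points T ω)) (knownPoints T ω)) with hF
  set P := sampleLaw lam T p
  set κ : ℝ := Nat.cast (Fintype.card ((Fin K → Fin N → Fin q) × (Fin K → Fin M))) with hκ
  have hBT (r : Fin K → Fin N → Fin q) (j : Fin K) : codeSet T a (r j) ⊆ Icc 0 T :=
    fun _ hx => hx.1
  have hBm (r : Fin K → Fin N → Fin q) (j : Fin K) : MeasurableSet (codeSet T a (r j)) :=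
    measurableSet_codeSet T a (r j)
  have hpt (ω : Sample) : ∑ x, F x ω ≤ ENNReal.ofReal κ *
      (ENNReal.ofReal (d + η) + (atypical T N q n₁ s₀).indicator (fun _ => 1) ω) := by
    by_cases hω : ω ∈ atypical T N q n₁ s₀
    · rw [indicator_of_mem hω]
      calc ∑ x, F x ω ≤ ∑ _x : (Fin K → Fin N → Fin q) × (Fin K → Fin M), (1 : ℝ≥0∞) :=
            Finset.sum_le_sum fun x _ => distortion_le_one hT (hBT x.1) ω
        _ = ENNReal.ofReal κ * 1 := by
            rw [hκ, ENNReal.ofReal_natCast, Finset.sum_const, nsmul_eq_mul]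
            rfl
        _ ≤ _ := by
            gcongr
            exact le_add_self
    · rw [indicator_of_notMem hω, add_zero]
      have hfail := sum_codingFailure_le hT K hM ha hω
      calc ∑ x, F x ω ≤ ∑ x : (Fin K → Fin N → Fin q) × (Fin K → Fin M), ENNReal.ofReal (d +
            if CodingFailure (fun A : Set ℝ => (points T ω : Set ℝ) ⊆ A)
              (fun A => (knownPoints T ω : Set ℝ) ⊆ A) (fun j => codeSet T a (x.1 j)) x.2
            then 1 else 0) :=
            Finset.sum_le_sum fun x _ => distortion_le_add_failure hT (hBT x.1) hd0
              (fun j => volume_codeSet_le hT ha (x.1 j)) ω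
        _ ≤ ENNReal.ofReal (κ * (d + η)) := by
            rw [← ENNReal.ofReal_sum_of_nonneg fun x _ => add_nonneg hd0 (by positivity)]
            refine ENNReal.ofReal_le_ofReal ?_
            rw [Finset.sum_add_distrib, Finset.sum_const, nsmul_eq_mul, Finset.card_univ, mul_add]
            gcongr
        _ = _ := ENNReal.ofReal_mul (by positivity)
  have hint : ∑ x, ∫⁻ ω, F x ω ∂P ≤ ENNReal.ofReal κ *
      (ENNReal.ofReal (d + η) + P (atypical T N q n₁ s₀)) := by
    rw [← lintegral_finsetSum _ fun x _ => measurable_distortion hT (hBm x.1)]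
    refine (lintegral_mono hpt).trans ?_
    rw [lintegral_const_mul' _ _ ENNReal.ofReal_ne_top, lintegral_add_left measurable_const]
    gcongr
    · simp
    · simpa using lintegral_indicator_const_le (μ := P) (atypical T N q n₁ s₀) 1
  by_contra! hcon
  have hne : (Finset.univ : Finset ((Fin K → Fin N → Fin q) × (Fin K → Fin M))).Nonempty :=
    ⟨(fun _ _ => 0, fun _ => ⟨0, hM⟩), Finset.mem_univ _⟩
  refine (hint.trans_lt ?_).false
  refine lt_of_eq_of_lt ?_ (ENNReal.sum_lt_sum_of_nonempty hne fun x _ => hcon x.1 x.2)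
  rw [Finset.sum_const, nsmul_eq_mul, hκ, ENNReal.ofReal_natCast]
  rfl

lemma exists_fraction_between {D D' : ℝ} (hD : 0 < D) (hDD' : D < D') :
    ∃ a q : ℕ, 0 < a ∧ 0 < q ∧ D < (a : ℝ) / q ∧ (a : ℝ) / q < D' := by
  obtain ⟨x, hx1, hx2⟩ := exists_rat_btwn hDD'
  have hx0 : 0 < x := by exact_mod_cast hD.trans hx1
  have hx : (x : ℝ) = (x.num.toNat : ℝ) / x.den := by
    have h1 : ((x.num.toNat : ℤ) : ℝ) = x.num := by
      exact_mod_cast Int.toNat_of_nonneg (Rat.num_nonneg.2 hx0.le)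
    rw [Rat.cast_def, ← h1, Int.cast_natCast]
  exact ⟨x.num.toNat, x.den, by have := Rat.num_pos.2 hx0; omega, x.den_pos, hx ▸ hx1, hx ▸ hx2⟩

lemma sampleLaw_atypical_le {lam T ν σ η : ℝ} {p : unitInterval} (hT : 0 < T) (hν : 0 < ν)
    (N q : ℕ) [NeZero N] [NeZero q]
    (h1 : sampleLaw lam T p {ω | ν * T < markCount (fun _ => true) ω} ≤ ENNReal.ofReal η)
    (h2 : sampleLaw lam T p {ω | (markCount id ω : ℝ) < σ * T} ≤ ENNReal.ofReal η)
    (h3 : (⌊ν * T⌋₊ : ℝ) ^ 2 / N ≤ η) :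
    sampleLaw lam T p (atypical T N q ⌊ν * T⌋₊ ⌈σ * T⌉₊) ≤ ENNReal.ofReal (3 * η) := by
  have hη : 0 ≤ η := le_trans (by positivity) h3
  rw [show 3 * η = η + η + η by ring, ENNReal.ofReal_add (by positivity) hη,
    ENNReal.ofReal_add hη hη]
  refine (measure_union_le _ _).trans (add_le_add ((measure_union_le _ _).trans
    (add_le_add ?_ ?_)) ?_)
  · refine (measure_mono fun ω hω => ?_).trans h1
    simpa [markCount] using (Nat.floor_lt (by positivity)).1 hω
  · exact (measure_mono fun ω hω => Nat.lt_ceil.1 hω).trans h2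
  · exact (sampleLaw_collision_le hT lam p N q _).trans (ENNReal.ofReal_le_ofReal h3)

lemma one_sub_pow_le_exp {x t : ℝ} (hx : 0 < x) (hx1 : x ≤ 1) :
    (1 - x) ^ ⌈t / x⌉₊ ≤ Real.exp (-t) := by
  calc (1 - x) ^ ⌈t / x⌉₊ ≤ Real.exp (-x) ^ ⌈t / x⌉₊ :=
        pow_le_pow_left₀ (by linarith) (Real.one_sub_le_exp_neg x) _
    _ = Real.exp (-(⌈t / x⌉₊ * x)) := by rw [← Real.exp_nat_mul]; ring_nf
    _ ≤ Real.exp (-t) := by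
        have := (div_le_iff₀ hx).1 (Nat.le_ceil (t / x))
        gcongr

/-- The expected number of wrong candidates before hashing. Negative `σ` is allowed, as happens when
`p = 0`. -/
lemma codebook_size_mul_pow_le {d t ν σ T : ℝ} (hd : 0 < d) (hd1 : d < 1) (ht : 0 ≤ t)
    (hν : 0 < ν) (hT : 0 < T) :
    ⌈t / d ^ ⌊ν * T⌋₊⌉₊ * d ^ ⌈σ * T⌉₊ ≤
      (t + 1) * (2 : ℝ) ^ (-Real.logb 2 d * (ν - σ) * T) := by
  have h1 : (⌈t / d ^ ⌊ν * T⌋₊⌉₊ : ℝ) ≤ (t + 1) / d ^ (ν * T) := by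
    have hx : (1 : ℝ) ≤ 1 / d ^ (⌊ν * T⌋₊) :=
      (one_le_div (by positivity)).2 (pow_le_one₀ hd.le hd1.le)
    have h2 : d ^ (ν * T) ≤ d ^ ⌊ν * T⌋₊ := by
      rw [← Real.rpow_natCast]
      exact Real.rpow_le_rpow_of_exponent_ge hd hd1.le (Nat.floor_le (by positivity))
    calc (⌈t / d ^ ⌊ν * T⌋₊⌉₊ : ℝ) ≤ t / d ^ ⌊ν * T⌋₊ + 1 :=
          (Nat.ceil_lt_add_one (by positivity)).le
      _ ≤ t / d ^ ⌊ν * T⌋₊ + 1 / d ^ ⌊ν * T⌋₊ := by gcongr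
      _ = (t + 1) / d ^ ⌊ν * T⌋₊ := by ring
      _ ≤ (t + 1) / d ^ (ν * T) := by gcongr
  have h2 : d ^ ⌈σ * T⌉₊ ≤ d ^ (σ * T) := by
    rw [← Real.rpow_natCast]
    exact Real.rpow_le_rpow_of_exponent_ge hd hd1.le (Nat.le_ceil _)
  calc _ ≤ (t + 1) / d ^ (ν * T) * d ^ (σ * T) := by gcongr
    _ = (t + 1) * d ^ (σ * T - ν * T) := by rw [Real.rpow_sub hd]; ring
    _ = _ := by
        congr 1
        nth_rewrite 1 [← Real.rpow_logb two_pos (by norm_num) hd]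
        rw [← Real.rpow_mul zero_le_two]
        congr 1
        ring

theorem wzAchievable_of_lt_one {lam D : ℝ} (p : unitInterval) (hlam : 0 < lam) (hD : 0 < D)
    (hD1 : D < 1) : WZAchievable lam p (-((1 - p) * lam) * Real.logb 2 D) D := by
  intro ε hε
  have hp1 : 0 ≤ 1 - (p : ℝ) := by linarith [p.2.2]
  -- The error budget is four times `ε / 4`: the excess of `a / q` over `D`, no covering codeword, a
  -- wrong candidate, and atypical outcomes (three times `ε / 12`).
  obtain ⟨a, q, ha, hq, hd1, hd2⟩ := exists_fraction_between hD
    (lt_min hD1 (lt_add_of_pos_right D (show 0 < ε / 4 by positivity)))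
  set d : ℝ := (a : ℝ) / q with hd
  have hd1' : d < 1 := hd2.trans_le (min_le_left _ _)
  have hdε : d < D + ε / 4 := hd2.trans_le (min_le_right _ _)
  have hd0 : 0 < d := hD.trans hd1
  have haq : a ≤ q := by
    have := (div_lt_one (by exact_mod_cast hq)).1 hd1'
    exact_mod_cast this.le
  have : NeZero q := ⟨hq.ne'⟩
  set L := -Real.logb 2 d with hL
  have hL0 : 0 < L := neg_pos.2 (Real.logb_neg one_lt_two hd0 hd1')
  have hLD : L ≤ -Real.logb 2 D := neg_le_neg (Real.logb_le_logb_of_le one_lt_two hD hd1.le)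
  set R := -((1 - p) * lam) * Real.logb 2 D with hR
  have hLR : L * ((1 - p) * lam) ≤ R := by
    have := mul_le_mul_of_nonneg_right hLD (mul_nonneg hp1 hlam.le)
    linarith
  have hR0 : 0 ≤ R := le_trans (by positivity) hLR
  -- With this `δ`, `L * (ν - σ)` is at most `R + ε / 2`, so the rate `R + ε` leaves a factor `2 ^
  -- (-(ε / 2) * T)`.
  set δ := ε / (4 * L) with hδ
  have hδ0 : 0 < δ := by positivity
  have hLδ : L * δ = ε / 4 := by rw [hδ]; field_simp
  set ν := lam + δ with hν
  set σ := lam * p - δ with hσ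
  set t := max 0 (-Real.log (ε / 4)) with ht
  have ht0 : 0 ≤ t := le_max_left _ _
  have hexpt : Real.exp (-t) ≤ ε / 4 := by
    have : -t ≤ Real.log (ε / 4) := neg_le.1 (le_max_right _ _)
    exact (Real.exp_le_exp.2 this).trans_eq (Real.exp_log (by positivity))
  have hm1 : markProb p (fun _ => true) = 1 := by simp [markProb]
  have hm2 : markProb p id = p := by simp [markProb]
  have hη : 0 < ENNReal.ofReal (ε / 12) := by simpa using hε
  have ev1 := (tendsto_lt_markCount (κ := ν) hlam p (fun _ => true) (by rw [hm1]; exact one_pos)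
    (by rw [hm1]; linarith)).eventually_le_const hη
  have ev2 := (tendsto_markCount_lt (κ := σ) hlam p id
    (by rw [hm2]; linarith)).eventually_le_const hη
  have hexp : Filter.Tendsto (fun T : ℝ => (2 : ℝ) ^ (-(ε / 2) * T)) Filter.atTop (nhds 0) :=
    (tendsto_rpow_atBot_of_base_gt_one 2 one_lt_two).comp
      (Filter.tendsto_id.const_mul_atTop_of_neg (by linarith))
  have ev3 := hexp.eventually_le_const (show 0 < ε / 4 / (2 * (t + 1)) by positivity)
  have ev4 := hexp.eventually_le_const (show (0 : ℝ) < 1 / 4 by positivity)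
  obtain ⟨T₁, hT₁⟩ := Filter.eventually_atTop.1 (ev1.and (ev2.and (ev3.and ev4)))
  refine ⟨max T₁ 1, by positivity, fun T hT => ?_⟩
  obtain ⟨h1, h2, h3, h4⟩ := hT₁ T ((le_max_left _ _).trans hT.le)
  have hT0 : 0 < T := one_pos.trans ((le_max_right _ _).trans_lt hT)
  -- One message is reserved for reporting that no codeword covers the points. With at least `4`
  -- before rounding, rounding and this loss cost at most a factor `2`.
  have hbig : (4 : ℝ) ≤ (2 : ℝ) ^ (T * (R + ε)) := by
    have h5 : (2 : ℝ) ^ (-(ε / 2) * T) * (2 : ℝ) ^ (ε / 2 * T) = 1 := by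
      rw [← Real.rpow_add two_pos]; simp
    have h6 : (2 : ℝ) ^ (ε / 2 * T) ≤ (2 : ℝ) ^ (T * (R + ε)) :=
      Real.rpow_le_rpow_of_exponent_le one_le_two (by nlinarith)
    nlinarith [Real.rpow_pos_of_pos two_pos (ε / 2 * T)]
  obtain ⟨M, hM⟩ : ∃ M : ℕ, ⌊(2 : ℝ) ^ (T * (R + ε))⌋₊ = M + 1 :=
    Nat.exists_eq_succ_of_ne_zero (Nat.floor_pos.2 (by linarith)).ne'
  have hMge : (2 : ℝ) ^ (T * (R + ε)) / 2 ≤ M := by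
    have := Nat.lt_floor_add_one ((2 : ℝ) ^ (T * (R + ε)))
    rw [hM] at this
    push_cast at this
    linarith
  have hMpos : (0 : ℝ) < M := by linarith
  -- `N` may depend on `T` freely, since neither the codebook size nor the number of messages
  -- involves it.
  obtain ⟨N, hN⟩ : ∃ N : ℕ, (⌊ν * T⌋₊ : ℝ) ^ 2 / (ε / 12) < N := exists_nat_gt _
  have hN0 : (0 : ℝ) < N := lt_of_le_of_lt (by positivity) hN
  have : NeZero N := ⟨by rintro rfl; simp at hN0⟩
  have hcol : (⌊ν * T⌋₊ : ℝ) ^ 2 / N ≤ ε / 12 := by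
    rw [div_le_iff₀ hN0]
    rw [div_lt_iff₀ (by positivity)] at hN
    linarith
  have hν0 : 0 < ν := by positivity
  have hatyp := sampleLaw_atypical_le hT0 hν0 N q h1 h2 hcol
  obtain ⟨r, h, hE⟩ := exists_code hT0 lam p N q ⌈t / d ^ ⌊ν * T⌋₊⌉₊ (n₁ := ⌊ν * T⌋₊)
    (s₀ := ⌈σ * T⌉₊) (M := M) (by exact_mod_cast hMpos) haq
  have hKM : ⌈t / d ^ ⌊ν * T⌋₊⌉₊ * d ^ ⌈σ * T⌉₊ / M ≤ ε / 4 := by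
    rw [div_le_iff₀ hMpos]
    refine (codebook_size_mul_pow_le hd0 hd1' ht0 hν0 hT0).trans ?_
    have h5 : (2 : ℝ) ^ (L * (ν - σ) * T) ≤ (2 : ℝ) ^ (-(ε / 2) * T) * (2 : ℝ) ^ (T * (R + ε)) := by
      rw [← Real.rpow_add two_pos]
      refine Real.rpow_le_rpow_of_exponent_le one_le_two ?_
      have h6 : L * (ν - σ) = L * ((1 - p) * lam) + 2 * (L * δ) := by rw [hν, hσ]; ring
      rw [h6, hLδ]
      nlinarith
    calc (t + 1) * (2 : ℝ) ^ (L * (ν - σ) * T)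
        ≤ (t + 1) * (ε / 4 / (2 * (t + 1)) * (2 : ℝ) ^ (T * (R + ε))) := by
          gcongr
          exact h5.trans (by gcongr)
      _ = ε / 4 * ((2 : ℝ) ^ (T * (R + ε)) / 2) := by field_simp
      _ ≤ ε / 4 * M := by gcongr
  have hpow := one_sub_pow_le_exp (t := t) (pow_pos hd0 ⌊ν * T⌋₊) (pow_le_one₀ hd0.le hd1'.le)
  set B : Fin ⌈t / d ^ ⌊ν * T⌋₊⌉₊ → Set ℝ := fun j => codeSet T a (r j)
  have hBm (j) : MeasurableSet (B j) := measurableSet_codeSet T a (r j)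
  have hBT (j) : B j ⊆ Icc 0 T := fun _ hx => hx.1
  let e : Message T (R + ε) ≃ Option (Fin M) := (finCongr hM).trans (finSuccEquiv M)
  refine ⟨fun x => e.symm (encode B h x),
    ⟨fun m s => decode T B h (e m) s, fun m s => decode_subset hBT _ _,
      fun m s => (measurableSet_decode hBm _ _).nullMeasurableSet⟩,
    measurable_encode hBm e.symm, ?_⟩
  simp only [Equiv.apply_symm_apply]
  refine ⟨(measurable_distortion hT0 hBm).aemeasurable, hE.trans ?_⟩
  refine (add_le_add_right hatyp _).trans ?_
  have hsub : 0 ≤ 1 - d ^ ⌊ν * T⌋₊ := sub_nonneg.2 (pow_le_one₀ hd0.le hd1'.le)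
  rw [← ENNReal.ofReal_add (by positivity) (by positivity)]
  refine ENNReal.ofReal_le_ofReal ?_
  linarith

theorem wzAchievable_zero_of_one_le {lam D : ℝ} (p : unitInterval) (hD1 : 1 ≤ D) :
    WZAchievable lam p 0 D := by
  intro ε hε
  refine ⟨1, one_pos, fun T hT => ?_⟩
  have hT0 : 0 < T := one_pos.trans hT
  have hpos : 0 < ⌊(2 : ℝ) ^ (T * (0 + ε))⌋₊ :=
    Nat.floor_pos.2 (Real.one_le_rpow one_le_two (by nlinarith))
  refine ⟨fun _ => ⟨0, hpos⟩, ⟨fun _ _ => Icc 0 T, fun _ _ => subset_rfl,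
    fun _ _ => measurableSet_Icc.nullMeasurableSet⟩, @measurable_const _ _ ⊤ patternSigma _, ?_⟩
  have h1 (ω : Sample) : distortion T (points T ω) (Icc 0 T) = 1 := by
    rw [distortion, if_pos (points_subset_Icc hT0 ω), Real.volume_Icc, sub_zero]
    exact ENNReal.div_self (by simpa using hT0) ENNReal.ofReal_ne_top
  simp only [h1]
  refine ⟨aemeasurable_const, ?_⟩
  simp only [lintegral_const, measure_univ, mul_one]
  exact ENNReal.one_le_ofReal.2 (by linarith)

theorem wzAchievable_ratePois {lam D : ℝ} (p : unitInterval) (hlam : 0 < lam) (hD : 0 < D) :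
    WZAchievable lam p (ratePois D ((1 - p) * lam)) D := by
  unfold ratePois
  split_ifs with h
  · exact wzAchievable_of_lt_one p hlam hD h
  · exact wzAchievable_zero_of_one_le p (not_lt.1 h)

end PoissonCover

end

theorem mainTheorem5 (D lam : ℝ) (hD : 0 < D) (hlam : 0 < lam) (p : unitInterval) :
    IsLeast {R : ℝ | PoissonCover.WZAchievable lam p R D}
        (PoissonCover.ratePois D ((1 - (p : ℝ)) * lam)) ∧
      IsLeast {R : ℝ | PoissonCover.InformedAchievable lam p R D}
        (PoissonCover.ratePois D ((1 - (p : ℝ)) * lam)) := by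
  have h := PoissonCover.wzAchievable_ratePois p hlam hD
  exact ⟨⟨h, fun _ hR => PoissonCover.ratePois_le_of_informedAchievable hlam hD hR.informed⟩,
    ⟨h.informed, fun _ hR => PoissonCover.ratePois_le_of_informedAchievable hlam hD hR⟩⟩
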